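/- Give each vertex of $\mathbb Z^2$ a state in $\{0,1,2\}$. For $p,q>0$ with $p+q<1$, let the initial states $\xi_0(x)$, $x\in\mathbb Z^2$, be independent with $\mathbb P(\xi_0(x)=1)=p$, $\mathbb P(\xi_0(x)=2)=q$ and $\mathbb P(\xi_0(x)=0)=1-p-q$. Given the configuration $\xi_t$ at time $t\in\{0,1,2,\dots\}$, all vertices are updated simultaneously as follows. - If $\xi_t(x)=0$: in the *standard variant*, $\xi_{t+1}(x)=1$ if at least two of the four nearest neighbors of $x$ are in state $1$ at time $t$; in the *modified variant*, $\xi_{t+1}(x)=1$ if at least one of the two horizontal neighbors and at least one of the two vertical neighbors of $x$ are in state $1$ at time $t$. Otherwise $\xi_{t+1}(x)=0$. - If $\xi_t(x)=1$ (both variants): $\xi_{t+1}(x)=2$ if at least two of the four nearest neighbors of $x$ are in state $2$ at time $t$; otherwise $\xi_{t+1}(x)=1$. - If $\xi_t(x)=2$: $\xi_{t+1}(x)=2$. **Theorem.** Let $q=q(p)>0$ be any function of $p$ such that $q\ll p^2/(\log(1/p))^2$, that is, $q(p)(\log(1/p))^2/p^2\to 0$ as $p\to 0^+$. Then, for both the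 standard and the modified variant, $$\mathbb P(\text{the origin is eventually not in state } 0)\to 1\qquad\text{as } p\to 0^+ .$$ -/

import Mathlib

open Filter Topology Asymptotics MeasureTheory

namespace TwoStage

/-- Configurations assigning to each vertex of the lattice `ℤ²` a state `0`, `1` or `2`. -/
abbrev Config : Type := ℤ × ℤ → Fin 3

/-- The two horizontal nearest neighbours of `x`. -/
def hNbrs (x : ℤ × ℤ) : Finset (ℤ × ℤ) := {(x.1 + 1, x.2), (x.1 - 1, x.2)}

/-- The two vertical nearest neighbours of `x`. -/
def vNbrs (x : ℤ × ℤ) : Finset (ℤ × ℤ) := {(x.1, x.2 + 1), (x.1, x.2 - 1)}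

/-- The number of horizontal nearest neighbours of `x` in state `i`. -/
def numH (i : Fin 3) (ξ : Config) (x : ℤ × ℤ) : ℕ := ((hNbrs x).filter fun y => ξ y = i).card

/-- The number of vertical nearest neighbours of `x` in state `i`. -/
def numV (i : Fin 3) (ξ : Config) (x : ℤ × ℤ) : ℕ := ((vNbrs x).filter fun y => ξ y = i).card

/-- The number of vertices in state `i` among the four nearest neighbours of `x`. -/
def num (i : Fin 3) (ξ : Config) (x : ℤ × ℤ) : ℕ := numH i ξ x + numV i ξ x

/-- The number of coordinate directions in which `x` has a nearest neighbour in state `i`. -/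
def numDir (i : Fin 3) (ξ : Config) (x : ℤ × ℤ) : ℕ :=
  (if 1 ≤ numH i ξ x then 1 else 0) + (if 1 ≤ numV i ξ x then 1 else 0)

/-- The two variants of the dynamics. -/
inductive Variant : Type
  | standard : Variant
  | modified : Variant

/-- The neighbour count that governs flips from `0` to `1`. -/
def Variant.count : Variant → Config → ℤ × ℤ → ℕ
  | .standard => num 1
  | .modified => numDir 1

/-- One synchronous update. A `0` becomes `1` if its count of `1`s (according to the variant) is at
least two, a `1` becomes `2` if it has at least two nearest neighbours in state `2`, and a `2`
stays `2`. -/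
def step (v : Variant) (ξ : Config) : Config := fun x =>
  if ξ x = 0 then (if 2 ≤ v.count ξ x then 1 else 0)
  else if ξ x = 1 then (if 2 ≤ num 2 ξ x then 2 else 1)
  else 2

/-- The configuration at time `t` started from `ξ₀`. -/
def evolve (v : Variant) (ξ₀ : Config) : ℕ → Config
  | 0 => ξ₀
  | t + 1 => step v (evolve v ξ₀ t)

/-- The law of the initial state of one vertex: `1` with probability `p`, `2` with probability `q`,
and `0` with probability `1 - p - q` (meaningful when `0 ≤ p`, `0 ≤ q` and `p + q ≤ 1`). -/
noncomputable def siteLaw (p q : ℝ) : Measure (Fin 3) :=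
  ENNReal.ofReal (1 - p - q) • Measure.dirac 0 + ENNReal.ofReal p • Measure.dirac 1 +
    ENNReal.ofReal q • Measure.dirac 2

/-- The law of the initial configuration: the uniform product measure on `{0,1,2}^(ℤ²)`. -/
noncomputable def initialLaw (p q : ℝ) : Measure Config :=
  Measure.infinitePi fun _ : ℤ × ℤ => siteLaw p q

/-- The set of initial configurations for which the origin is eventually not in state `0`. -/
def originLeavesZero (v : Variant) : Set Config :=
  {ξ₀ | ∀ᶠ t : ℕ in atTop, evolve v ξ₀ t (0, 0) ≠ 0}

end TwoStage

/-!
The proof compares two growth processes on boxes of side `L`, where `L` is about `2 p⁻¹ log p⁻¹`.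
By the hypothesis on `q`, the product `L² q` tends to zero, so a box typically contains no `2` near
it, while `L` is large enough for every row and column of the box to contain a `1`. Call such a box
good. A good box next to a box full of `1`s fills up with `1`s (`FillClosed.spread`), under both
variants of the rule, provided that no `2` intervenes.

*Nuclei.* A box without `2`s fills up by itself if its first `O(p⁻¹)` diagonal vertices are `1`s and
each of its further hooks has a `1` in both arms (`FillClosed.nucleus`). This has probability at least
`exp (-O(L))` (`le_prob_nucleus`), so a nucleus is expected at distance `exp (O(L))`.

*Percolation of good boxes.* To travel from the nucleus to the origin, boxes are grouped into cells
of `11 × 11` cells of the level below. A cell is good if its bad subcells are pairwise close.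
Neighbouring good cells share a full row or column of good subcells, so that filling passes from one
to the other (`Spread.up`), and independence of distant cells makes the probability of a bad cell
decay doubly exponentially in the level (`prob_not_good_le`). In a row of `exp (O(L))` cells of
level `L`, all cells are therefore good with high probability, and one of them contains a nucleus
from which its surroundings can be reached (`prob_no_seedEvent_le`).

*Confinement of the `2`s.* The `1`s need at most `T = exp (O(L))` steps, and information travels at
unit speed, so only the `2`s initially within distance `T` matter. At worst they perform
two-neighbour bootstrap percolation. By the Aizenman–Lebowitz argument (`exists_twoClosed`), they
stay within distance `L` of their initial positions, and so outside the good boxes, unless some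
square of side `2L` contains more than `L / 2` initial `2`s; this has probability at most
`exp (O(L)) (O(L² q)) ^ (L / 2)`, which tends to zero because `L² q` does
(`prob_not_noDenseSquare_le`).
-/

namespace TwoStage

/-! ### Confinement of the state `2` -/

/-- `y` is a nearest neighbour of `x`. -/
def Nbr (x y : ℤ × ℤ) : Prop := y ∈ hNbrs x ∨ y ∈ vNbrs x

lemma mem_hNbrs {x y : ℤ × ℤ} :
    y ∈ hNbrs x ↔ y.2 = x.2 ∧ (y.1 = x.1 + 1 ∨ y.1 = x.1 - 1) := by
  obtain ⟨a, b⟩ := y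
  simp only [hNbrs, Finset.mem_insert, Finset.mem_singleton, Prod.mk.injEq]
  tauto

lemma mem_vNbrs {x y : ℤ × ℤ} :
    y ∈ vNbrs x ↔ y.1 = x.1 ∧ (y.2 = x.2 + 1 ∨ y.2 = x.2 - 1) := by
  obtain ⟨a, b⟩ := y
  simp only [vNbrs, Finset.mem_insert, Finset.mem_singleton, Prod.mk.injEq]
  tauto

lemma exists_pair_of_two_le_num {i : Fin 3} {ξ : Config} {x : ℤ × ℤ} (h : 2 ≤ num i ξ x) :
    ∃ y z, y ≠ z ∧ Nbr x y ∧ Nbr x z ∧ ξ y = i ∧ ξ z = i := by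
  have hd : Disjoint ((hNbrs x).filter fun y => ξ y = i) ((vNbrs x).filter fun y => ξ y = i) := by
    rw [Finset.disjoint_left]
    intro y hy hy'
    have h1 := mem_hNbrs.1 (Finset.mem_filter.1 hy).1
    have h2 := mem_vNbrs.1 (Finset.mem_filter.1 hy').1
    omega
  have hc : 1 < (((hNbrs x).filter fun y => ξ y = i) ∪
      ((vNbrs x).filter fun y => ξ y = i)).card := by
    rw [Finset.card_union_of_disjoint hd]; exact h
  obtain ⟨y, hy, z, hz, hyz⟩ := Finset.one_lt_card.1 hc
  simp only [Finset.mem_union, Finset.mem_filter] at hy hz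
  refine ⟨y, z, hyz, ?_, ?_, ?_, ?_⟩ <;> first | (unfold Nbr; tauto) | tauto

/-- A set of vertices is stable under two-neighbour bootstrap percolation if it contains every
vertex having two distinct neighbours in it. -/
def TwoClosed (X : Set (ℤ × ℤ)) : Prop :=
  ∀ x y z, y ≠ z → Nbr x y → Nbr x z → y ∈ X → z ∈ X → x ∈ X

lemma step_eq_two {v : Variant} {ξ : Config} {x : ℤ × ℤ} (h : step v ξ x = 2) :
    ξ x = 2 ∨ 2 ≤ num 2 ξ x := by
  unfold step at h
  by_cases h0 : ξ x = 0
  · rw [if_pos h0] at h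
    split_ifs at h <;> simp at h
  · rw [if_neg h0] at h
    by_cases h1 : ξ x = 1
    · rw [if_pos h1] at h
      split_ifs at h with h2
      · exact Or.inr h2
      · simp at h
    · left; omega

/-- The `2`s travel at speed at most one, and at worst they perform two-neighbour bootstrap
percolation: whatever the `1`s do, the `2`s near `x` up to time `t` lie in every stable set that
contains the initial `2`s at distance at most `t`. -/
lemma mem_of_evolve_eq_two {v : Variant} {ω : Config} {X : Set (ℤ × ℤ)} (hX : TwoClosed X) :
    ∀ (t : ℕ) (x : ℤ × ℤ),
      (∀ y : ℤ × ℤ, |y.1 - x.1| ≤ t → |y.2 - x.2| ≤ t → ω y = 2 → y ∈ X) →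
      evolve v ω t x = 2 → x ∈ X
  | 0, x, hx, h => hx x (by simp) (by simp) h
  | t + 1, x, hx, h => by
    have ih := mem_of_evolve_eq_two (v := v) (ω := ω) hX t
    have key : ∀ y, (y = x ∨ Nbr x y) → evolve v ω t y = 2 → y ∈ X := by
      intro y hy h2
      refine ih y (fun z h1 h3 hz => ?_) h2
      have : |y.1 - x.1| ≤ 1 ∧ |y.2 - x.2| ≤ 1 := by
        rcases hy with rfl | hy | hy
        · simp
        · have := mem_hNbrs.1 hy; simp only [abs_le]; omega
        · have := mem_vNbrs.1 hy; simp only [abs_le]; omega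
      apply hx z _ _ hz <;> push_cast <;> simp only [abs_le] at * <;> omega
    rcases step_eq_two h with h2 | h2
    · exact key x (Or.inl rfl) h2
    · obtain ⟨y, z, hyz, hy, hz, hy2, hz2⟩ := exists_pair_of_two_le_num h2
      exact hX x y z hyz hy hz (key y (Or.inr hy) hy2) (key z (Or.inr hz) hz2)

/-- The semi-perimeter of the rectangle `Icc a b`, counted in vertices. -/
def semiPerim (a b : ℤ × ℤ) : ℤ := (b.1 - a.1 + 1) + (b.2 - a.2 + 1)

/-- A cluster family of scale `L` of `A`: a finite family of triples `(S, a, b)`, where the sets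
`S` partition `A`, each `S` lies in the rectangle `Icc a b`, and this rectangle has semi-perimeter
at most `2 |S|` and at most `L`. -/
structure IsClusterFamily (A : Finset (ℤ × ℤ)) (lo hi : ℤ × ℤ) (L : ℕ)
    (F : Finset (Finset (ℤ × ℤ) × (ℤ × ℤ) × (ℤ × ℤ))) : Prop where
  nonempty : ∀ r ∈ F, r.1.Nonempty
  subset : ∀ r ∈ F, r.1 ⊆ A
  mem : ∀ r ∈ F, ∀ x ∈ r.1, r.2.1 ≤ x ∧ x ≤ r.2.2
  lo_le : ∀ r ∈ F, lo ≤ r.2.1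
  le_hi : ∀ r ∈ F, r.2.2 ≤ hi
  perim_card : ∀ r ∈ F, semiPerim r.2.1 r.2.2 ≤ 2 * r.1.card
  perim_le : ∀ r ∈ F, semiPerim r.2.1 r.2.2 ≤ L
  disj : ∀ r ∈ F, ∀ r' ∈ F, r ≠ r' → Disjoint r.1 r'.1
  cover : ∀ x ∈ A, ∃ r ∈ F, x ∈ r.1

/-- Two rectangles are close if they contain vertices at `ℓ¹`-distance at most two. -/
def Close (r r' : Finset (ℤ × ℤ) × (ℤ × ℤ) × (ℤ × ℤ)) : Prop :=
  ∃ y z : ℤ × ℤ, r.2.1 ≤ y ∧ y ≤ r.2.2 ∧ r'.2.1 ≤ z ∧ z ≤ r'.2.2 ∧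
    |y.1 - z.1| + |y.2 - z.2| ≤ 2

lemma IsClusterFamily.singletons {A : Finset (ℤ × ℤ)} {lo hi : ℤ × ℤ} {L : ℕ} (hL : 2 ≤ L)
    (hA : ∀ x ∈ A, lo ≤ x ∧ x ≤ hi) :
    IsClusterFamily A lo hi L (A.image fun x => ({x}, x, x)) := by
  constructor <;> simp only [Finset.mem_image, forall_exists_index, and_imp,
    forall_apply_eq_imp_iff₂]
  · simp
  · simp
  · simp
  · exact fun x hx => (hA x hx).1
  · exact fun x hx => (hA x hx).2
  · simp [semiPerim]
  · intro x hx; simp [semiPerim]; omega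
  · intro x _ y _ hxy
    simp only [ne_eq, Prod.mk.injEq, Finset.singleton_inj, and_self] at hxy
    simpa using hxy
  · intro x hx
    exact ⟨_, ⟨x, hx, rfl⟩, by simp⟩

/-- The smallest rectangle containing two close ones is at most as long as both together. -/
lemma semiPerim_hull_le {r r' : Finset (ℤ × ℤ) × (ℤ × ℤ) × (ℤ × ℤ)} (h : Close r r') :
    semiPerim (r.2.1 ⊓ r'.2.1) (r.2.2 ⊔ r'.2.2) ≤
      semiPerim r.2.1 r.2.2 + semiPerim r'.2.1 r'.2.2 := by
  obtain ⟨S, ⟨a1, a2⟩, ⟨b1, b2⟩⟩ := r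
  obtain ⟨S', ⟨a1', a2'⟩, ⟨b1', b2'⟩⟩ := r'
  obtain ⟨⟨y1, y2⟩, ⟨z1, z2⟩, h1, h2, h3, h4, h5⟩ := h
  simp only [Prod.mk_le_mk, Prod.mk_inf_mk, Prod.mk_sup_mk, semiPerim] at *
  have e1 : max b1 b1' - min a1 a1' ≤ (b1 - a1) + (b1' - a1') + |y1 - z1| := by
    rcases abs_cases (y1 - z1) with h | h <;> omega
  have e2 : max b2 b2' - min a2 a2' ≤ (b2 - a2) + (b2' - a2') + |y2 - z2| := by
    rcases abs_cases (y2 - z2) with h | h <;> omega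
  omega

open Classical in
/-- Two close clusters can be merged. The merged rectangle has semi-perimeter at most `2L`, so it fits
into a square of side `2L`; as there are no dense squares, its cluster has at most `L / 2` points,
and the semi-perimeter is at most `L` again. -/
lemma IsClusterFamily.merge {A : Finset (ℤ × ℤ)} {lo hi : ℤ × ℤ} {L : ℕ}
    {F : Finset (Finset (ℤ × ℤ) × (ℤ × ℤ) × (ℤ × ℤ))} (hF : IsClusterFamily A lo hi L F)
    (hdense : ∀ a, lo ≤ a → a ≤ hi →
      2 * (A.filter fun x => a ≤ x ∧ x ≤ a + (2 * (L : ℤ), 2 * (L : ℤ))).card ≤ L)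
    {r r' : Finset (ℤ × ℤ) × (ℤ × ℤ) × (ℤ × ℤ)} (hr : r ∈ F) (hr' : r' ∈ F) (hne : r ≠ r')
    (hc : Close r r') :
    ∃ F', IsClusterFamily A lo hi L F' ∧ F'.card < F.card := by
  set s : Finset (ℤ × ℤ) × (ℤ × ℤ) × (ℤ × ℤ) :=
    (r.1 ∪ r'.1, r.2.1 ⊓ r'.2.1, r.2.2 ⊔ r'.2.2) with hs
  have hcard : s.1.card = r.1.card + r'.1.card :=
    Finset.card_union_of_disjoint (hF.disj r hr r' hr' hne)
  have hper := semiPerim_hull_le hc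
  have hp1 := hF.perim_card r hr
  have hp2 := hF.perim_card r' hr'
  have hq1 := hF.perim_le r hr
  have hq2 := hF.perim_le r' hr'
  have hsub : s.1 ⊆ A := Finset.union_subset (hF.subset r hr) (hF.subset r' hr')
  have hmem : ∀ x ∈ s.1, s.2.1 ≤ x ∧ x ≤ s.2.2 := by
    intro x hx
    rcases Finset.mem_union.1 hx with hx | hx
    · have := hF.mem r hr x hx
      exact ⟨inf_le_left.trans this.1, this.2.trans le_sup_left⟩
    · have := hF.mem r' hr' x hx
      exact ⟨inf_le_right.trans this.1, this.2.trans le_sup_right⟩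
  have hlo : lo ≤ s.2.1 := le_inf (hF.lo_le r hr) (hF.lo_le r' hr')
  have hhi : s.2.2 ≤ hi := sup_le (hF.le_hi r hr) (hF.le_hi r' hr')
  obtain ⟨x0, hx0⟩ := hF.nonempty r hr
  have hx0s : x0 ∈ s.1 := Finset.mem_union_left _ hx0
  have hab : s.2.1 ≤ s.2.2 := (hmem x0 hx0s).1.trans (hmem x0 hx0s).2
  have hper2 : semiPerim s.2.1 s.2.2 ≤ 2 * L := by simp only [hs]; omega
  have hpers : semiPerim s.2.1 s.2.2 ≤ 2 * s.1.card := by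
    rw [hcard]; push_cast; simp only [hs]; omega
  have hsL : semiPerim s.2.1 s.2.2 ≤ L := by
    have h1 : s.1 ⊆ A.filter fun x => s.2.1 ≤ x ∧ x ≤ s.2.1 + (2 * (L : ℤ), 2 * (L : ℤ)) := by
      intro x hx
      refine Finset.mem_filter.2 ⟨hsub hx, (hmem x hx).1, (hmem x hx).2.trans ?_⟩
      simp only [semiPerim] at hper2
      constructor
      · have := hab.2; simp only [Prod.fst_add]; omega
      · have := hab.1; simp only [Prod.snd_add]; omega
    have h2 := hdense s.2.1 hlo (hab.trans hhi)
    have h3 := Finset.card_le_card h1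
    omega
  have hsdisj : ∀ u ∈ F, u ≠ r → u ≠ r' → Disjoint s.1 u.1 := fun u hu h1 h2 =>
    Finset.disjoint_union_left.2
      ⟨hF.disj r hr u hu (Ne.symm h1), hF.disj r' hr' u hu (Ne.symm h2)⟩
  have hin : ∀ u ∈ insert s ((F.erase r).erase r'), u = s ∨ (u ∈ F ∧ u ≠ r ∧ u ≠ r') := by
    intro u hu
    simp only [Finset.mem_insert, Finset.mem_erase] at hu
    tauto
  refine ⟨insert s ((F.erase r).erase r'), ⟨?_, ?_, ?_, ?_, ?_, ?_, ?_, ?_, ?_⟩, ?_⟩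
  · intro u hu
    rcases hin u hu with rfl | ⟨h, -⟩
    · exact ⟨x0, hx0s⟩
    · exact hF.nonempty u h
  · intro u hu
    rcases hin u hu with rfl | ⟨h, -⟩
    · exact hsub
    · exact hF.subset u h
  · intro u hu
    rcases hin u hu with rfl | ⟨h, -⟩
    · exact hmem
    · exact hF.mem u h
  · intro u hu
    rcases hin u hu with rfl | ⟨h, -⟩
    · exact hlo
    · exact hF.lo_le u h
  · intro u hu
    rcases hin u hu with rfl | ⟨h, -⟩
    · exact hhi
    · exact hF.le_hi u h
  · intro u hu
    rcases hin u hu with rfl | ⟨h, -⟩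
    · exact hpers
    · exact hF.perim_card u h
  · intro u hu
    rcases hin u hu with rfl | ⟨h, -⟩
    · exact hsL
    · exact hF.perim_le u h
  · intro u hu w hw huw
    rcases hin u hu with rfl | ⟨h, h1, h2⟩ <;> rcases hin w hw with rfl | ⟨h', h1', h2'⟩
    · exact absurd rfl huw
    · exact hsdisj w h' h1' h2'
    · exact (hsdisj u h h1 h2).symm
    · exact hF.disj u h w h' huw
  · intro x hx
    obtain ⟨u, hu, hxu⟩ := hF.cover x hx
    by_cases h1 : u = r
    · exact ⟨s, Finset.mem_insert_self _ _, Finset.mem_union_left _ (h1 ▸ hxu)⟩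
    by_cases h2 : u = r'
    · exact ⟨s, Finset.mem_insert_self _ _, Finset.mem_union_right _ (h2 ▸ hxu)⟩
    exact ⟨u, Finset.mem_insert_of_mem (Finset.mem_erase.2 ⟨h2, Finset.mem_erase.2 ⟨h1, hu⟩⟩), hxu⟩
  · have h1 : r' ∈ F.erase r := Finset.mem_erase.2 ⟨hne.symm, hr'⟩
    have h2 := Finset.card_erase_add_one h1
    have h3 := Finset.card_erase_add_one hr
    have h4 := Finset.card_insert_le s ((F.erase r).erase r')
    omega

/-- A cluster family with the fewest members has no two close rectangles. -/
lemma IsClusterFamily.exists_separated {A : Finset (ℤ × ℤ)} {lo hi : ℤ × ℤ} {L : ℕ}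
    (hL : 2 ≤ L) (hA : ∀ x ∈ A, lo ≤ x ∧ x ≤ hi)
    (hdense : ∀ a, lo ≤ a → a ≤ hi →
      2 * (A.filter fun x => a ≤ x ∧ x ≤ a + (2 * (L : ℤ), 2 * (L : ℤ))).card ≤ L) :
    ∃ F, IsClusterFamily A lo hi L F ∧ ∀ r ∈ F, ∀ r' ∈ F, r ≠ r' → ¬ Close r r' := by
  classical
  have hex : ∃ n, ∃ F, IsClusterFamily A lo hi L F ∧ F.card = n :=
    ⟨_, _, IsClusterFamily.singletons hL hA, rfl⟩
  obtain ⟨F, hF, hcard⟩ := Nat.find_spec hex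
  refine ⟨F, hF, fun r hr r' hr' hne hc => ?_⟩
  obtain ⟨F', hF', hlt⟩ := hF.merge (by convert hdense) hr hr' hne hc
  exact Nat.find_min hex (hcard ▸ hlt) ⟨F', hF', rfl⟩

/-- The Aizenman–Lebowitz argument: if no square of side `2L` contains more than `L / 2` points of
`A`, then two-neighbour bootstrap percolation started from `A` stays within distance `L` of `A`. -/
lemma exists_twoClosed {A : Finset (ℤ × ℤ)} {lo hi : ℤ × ℤ} {L : ℕ}
    (hL : 2 ≤ L) (hA : ∀ x ∈ A, lo ≤ x ∧ x ≤ hi)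
    (hdense : ∀ a, lo ≤ a → a ≤ hi →
      2 * (A.filter fun x => a ≤ x ∧ x ≤ a + (2 * (L : ℤ), 2 * (L : ℤ))).card ≤ L) :
    ∃ X : Set (ℤ × ℤ), TwoClosed X ∧ (∀ x ∈ A, x ∈ X) ∧
      ∀ x ∈ X, ∃ y ∈ A, |y.1 - x.1| < L ∧ |y.2 - x.2| < L := by
  obtain ⟨F, hF, hsep⟩ := IsClusterFamily.exists_separated hL hA hdense
  refine ⟨{x | ∃ r ∈ F, r.2.1 ≤ x ∧ x ≤ r.2.2}, ?_, ?_, ?_⟩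
  · rintro x y z hyz hy hz ⟨r, hr, hry⟩ ⟨r', hr', hrz⟩
    have hdist : |y.1 - z.1| + |y.2 - z.2| ≤ 2 := by
      rcases hy with hy | hy <;> rcases hz with hz | hz <;>
        simp only [mem_hNbrs, mem_vNbrs] at hy hz <;>
        rcases abs_cases (y.1 - z.1) with h | h <;> rcases abs_cases (y.2 - z.2) with h' | h' <;>
        omega
    by_cases hrr : r = r'
    · subst hrr
      refine ⟨r, hr, ?_⟩
      obtain ⟨S, ⟨a1, a2⟩, ⟨b1, b2⟩⟩ := r
      obtain ⟨y1, y2⟩ := y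
      obtain ⟨z1, z2⟩ := z
      obtain ⟨x1, x2⟩ := x
      simp only [Prod.mk_le_mk, ne_eq, Prod.mk.injEq, Nbr, mem_hNbrs, mem_vNbrs] at *
      omega
    · exact absurd ⟨y, z, hry.1, hry.2, hrz.1, hrz.2, hdist⟩ (hsep r hr r' hr' hrr)
  · intro x hx
    obtain ⟨r, hr, hxr⟩ := hF.cover x hx
    exact ⟨r, hr, hF.mem r hr x hxr⟩
  · rintro x ⟨r, hr, hx1, hx2⟩
    obtain ⟨y, hy⟩ := hF.nonempty r hr
    have hm := hF.mem r hr y hy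
    have hp := hF.perim_le r hr
    refine ⟨y, hF.subset r hr hy, ?_⟩
    have h1 := hx1.1; have h2 := hx1.2; have h3 := hx2.1; have h4 := hx2.2
    have h5 := hm.1.1; have h6 := hm.1.2; have h7 := hm.2.1; have h8 := hm.2.2
    simp only [semiPerim] at hp
    constructor <;> rw [abs_lt] <;> omega

/-! ### Hierarchical percolation of good cells -/

section Hierarchy

/-- On an integer interval, a property that is inherited from either neighbour and holds somewhere
holds everywhere. -/
lemma interval_fill {f : ℤ → Prop} {lo hi : ℤ}
    (hstep : ∀ i, lo ≤ i → i < hi → (f (i - 1) ∨ f (i + 1)) → f i)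
    {i₀ : ℤ} (h1 : lo ≤ i₀) (h2 : i₀ < hi) (h0 : f i₀) : ∀ i, lo ≤ i → i < hi → f i := by
  have up : ∀ n : ℕ, i₀ + n < hi → f (i₀ + n) := by
    intro n
    induction n with
    | zero => intro _; simpa using h0
    | succ n ih =>
      intro hn
      push_cast at hn
      refine hstep _ (by push_cast; omega) (by push_cast; omega) (Or.inl ?_)
      have := ih (by omega)
      convert this using 1; push_cast; ring
  have down : ∀ n : ℕ, lo ≤ i₀ - n → f (i₀ - n) := by
    intro n
    induction n with
    | zero => intro _; simpa using h0
    | succ n ih =>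
      intro hn
      push_cast at hn
      refine hstep _ (by push_cast; omega) (by push_cast; omega) (Or.inr ?_)
      have := ih (by omega)
      convert this using 1; push_cast; ring
  intro i hi1 hi2
  rcases le_total i₀ i with h | h
  · have := up (i - i₀).toNat (by omega)
    rwa [show i₀ + ((i - i₀).toNat : ℤ) = i by omega] at this
  · have := down (i₀ - i).toNat (by omega)
    rwa [show i₀ - ((i₀ - i).toNat : ℤ) = i by omega] at this

/-- The subcell of `c` with coordinates `(i, j)`, where a cell is divided into `11 × 11` cells of
the next lower level, `0 ≤ i, j < 11`. The number eleven exceeds `5 + 5`, as needed in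
`exists_outside_windows`. -/
def sub (c : ℤ × ℤ) (i j : ℤ) : ℤ × ℤ := (11 * c.1 + i, 11 * c.2 + j)

/-- A cell is good, relative to a notion `h` of goodness one level below, if all its bad subcells
are at pairwise sup-distance at most two. -/
def UpGood (h : ℤ × ℤ → Prop) (c : ℤ × ℤ) : Prop :=
  ∀ i j i' j' : ℤ, 0 ≤ i → i < 11 → 0 ≤ j → j < 11 → 0 ≤ i' → i' < 11 → 0 ≤ j' → j' < 11 →
    ¬ h (sub c i j) → ¬ h (sub c i' j') → |i - i'| ≤ 2 ∧ |j - j'| ≤ 2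

/-- Goodness of the cells of level `n`, starting from the notion `g` at level zero. -/
def Good (g : ℤ × ℤ → Prop) : ℕ → ℤ × ℤ → Prop
  | 0 => g
  | n + 1 => UpGood (Good g n)

/-- All subcells in the row `j` of `c` are good. -/
def FullRow (h : ℤ × ℤ → Prop) (c : ℤ × ℤ) (j : ℤ) : Prop :=
  ∀ i : ℤ, 0 ≤ i → i < 11 → h (sub c i j)

/-- All subcells in the column `i` of `c` are good. -/
def FullCol (h : ℤ × ℤ → Prop) (c : ℤ × ℤ) (i : ℤ) : Prop :=
  ∀ j : ℤ, 0 ≤ j → j < 11 → h (sub c i j)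

/-- The set `X` of cells spreads to neighbouring cells with the property `h`. -/
def Spread (h : ℤ × ℤ → Prop) (X : Set (ℤ × ℤ)) : Prop :=
  ∀ c c', c ∈ X → Nbr c c' → h c' → c' ∈ X

/-- The good cells in which all subcells on full rows and full columns belong to `X`. -/
def upSet (h : ℤ × ℤ → Prop) (X : Set (ℤ × ℤ)) : Set (ℤ × ℤ) :=
  {c | UpGood h c ∧ ∀ i j : ℤ, 0 ≤ i → i < 11 → 0 ≤ j → j < 11 →
    FullRow h c j ∨ FullCol h c i → sub c i j ∈ X}

variable {h : ℤ × ℤ → Prop} {X : Set (ℤ × ℤ)}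

/-- The bad rows lie within distance two of any one of them. -/
lemma UpGood.exists_fullRow {c : ℤ × ℤ} (hc : UpGood h c) :
    ∃ a : ℤ, ∀ j, 0 ≤ j → j < 11 → (j < a - 2 ∨ a + 2 < j) → FullRow h c j := by
  by_cases hb : ∃ i j : ℤ, 0 ≤ i ∧ i < 11 ∧ 0 ≤ j ∧ j < 11 ∧ ¬ h (sub c i j)
  · obtain ⟨i, j, hi, hi', hj, hj', hbad⟩ := hb
    refine ⟨j, fun k hk hk' hkj l hl hl' => ?_⟩
    by_contra hbad'
    have := (hc i j l k hi hi' hj hj' hl hl' hk hk' hbad hbad').2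
    rw [abs_le] at this
    omega
  · push Not at hb
    exact ⟨0, fun j hj hj' _ i hi hi' => hb i j hi hi' hj hj'⟩

lemma UpGood.exists_fullCol {c : ℤ × ℤ} (hc : UpGood h c) :
    ∃ a : ℤ, ∀ i, 0 ≤ i → i < 11 → (i < a - 2 ∨ a + 2 < i) → FullCol h c i := by
  by_cases hb : ∃ i j : ℤ, 0 ≤ i ∧ i < 11 ∧ 0 ≤ j ∧ j < 11 ∧ ¬ h (sub c i j)
  · obtain ⟨i, j, hi, hi', hj, hj', hbad⟩ := hb
    refine ⟨i, fun k hk hk' hkj l hl hl' => ?_⟩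
    by_contra hbad'
    have := (hc i j k l hi hi' hj hj' hk hk' hl hl' hbad hbad').1
    rw [abs_le] at this
    omega
  · push Not at hb
    exact ⟨0, fun i hi hi' _ j hj hj' => hb i j hi hi' hj hj'⟩

/-- Two windows of five consecutive integers do not cover eleven consecutive integers. -/
lemma exists_outside_windows (a b : ℤ) :
    ∃ j : ℤ, 0 ≤ j ∧ j < 11 ∧ (j < a - 2 ∨ a + 2 < j) ∧ (j < b - 2 ∨ b + 2 < j) := by
  by_contra hcon
  push Not at hcon
  have h0 := hcon 0 (by norm_num) (by norm_num)
  have h5 := hcon 5 (by norm_num) (by norm_num)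
  have h10 := hcon 10 (by norm_num) (by norm_num)
  omega

lemma Spread.row (hX : Spread h X) {c : ℤ × ℤ} {j : ℤ} (hrow : FullRow h c j) {i₀ : ℤ}
    (h1 : 0 ≤ i₀) (h2 : i₀ < 11) (h0 : sub c i₀ j ∈ X) :
    ∀ i, 0 ≤ i → i < 11 → sub c i j ∈ X := by
  refine interval_fill (f := fun i => sub c i j ∈ X) (fun i hi hi' hn => ?_) h1 h2 h0
  rcases hn with hn | hn
  · exact hX _ _ hn (Or.inl (mem_hNbrs.2 (by simp [sub]; omega))) (hrow i hi hi')
  · exact hX _ _ hn (Or.inl (mem_hNbrs.2 (by simp [sub]; omega))) (hrow i hi hi')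

lemma Spread.col (hX : Spread h X) {c : ℤ × ℤ} {i : ℤ} (hcol : FullCol h c i) {j₀ : ℤ}
    (h1 : 0 ≤ j₀) (h2 : j₀ < 11) (h0 : sub c i j₀ ∈ X) :
    ∀ j, 0 ≤ j → j < 11 → sub c i j ∈ X := by
  refine interval_fill (f := fun j => sub c i j ∈ X) (fun j hj hj' hn => ?_) h1 h2 h0
  rcases hn with hn | hn
  · exact hX _ _ hn (Or.inr (mem_vNbrs.2 (by simp [sub]; omega))) (hcol j hj hj')
  · exact hX _ _ hn (Or.inr (mem_vNbrs.2 (by simp [sub]; omega))) (hcol j hj hj')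

lemma Spread.mem_upSet_of_row (hX : Spread h X) {c : ℤ × ℤ} (hc : UpGood h c) {i₀ j₀ : ℤ}
    (hi : 0 ≤ i₀) (hi' : i₀ < 11) (hj : 0 ≤ j₀) (hj' : j₀ < 11) (hrow : FullRow h c j₀)
    (h0 : sub c i₀ j₀ ∈ X) : c ∈ upSet h X := by
  obtain ⟨a, ha⟩ := hc.exists_fullCol
  obtain ⟨k, hk, hk', hka, -⟩ := exists_outside_windows a a
  have hr := hX.row hrow hi hi' h0
  have hcol := hX.col (ha k hk hk' hka) hj hj' (hr k hk hk')
  refine ⟨hc, fun i j h1 h2 h3 h4 hf => ?_⟩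
  rcases hf with hf | hf
  · exact hX.row hf hk hk' (hcol j h3 h4) i h1 h2
  · exact hX.col hf hj hj' (hr i h1 h2) j h3 h4

lemma Spread.mem_upSet_of_col (hX : Spread h X) {c : ℤ × ℤ} (hc : UpGood h c) {i₀ j₀ : ℤ}
    (hi : 0 ≤ i₀) (hi' : i₀ < 11) (hj : 0 ≤ j₀) (hj' : j₀ < 11) (hcol : FullCol h c i₀)
    (h0 : sub c i₀ j₀ ∈ X) : c ∈ upSet h X := by
  obtain ⟨a, ha⟩ := hc.exists_fullRow
  obtain ⟨k, hk, hk', hka, -⟩ := exists_outside_windows a a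
  have hr := hX.col hcol hj hj' h0
  exact hX.mem_upSet_of_row hc hi hi' hk hk' (ha k hk hk' hka) (hr k hk hk')

/-- The spreading property passes to the next level: neighbouring good cells have a full row or a
full column in common. -/
lemma Spread.up (hX : Spread h X) : Spread (UpGood h) (upSet h X) := by
  rintro c c' ⟨hc, hcX⟩ hn hc'
  rcases hn with hn | hn
  · obtain ⟨a, ha⟩ := hc.exists_fullRow
    obtain ⟨a', ha'⟩ := hc'.exists_fullRow
    obtain ⟨j, hj, hj', hja, hja'⟩ := exists_outside_windows a a'
    have hrow := ha j hj hj' hja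
    have hrow' := ha' j hj hj' hja'
    obtain ⟨h2, h1 | h1⟩ := mem_hNbrs.1 hn
    · refine hX.mem_upSet_of_row hc' (i₀ := 0) (by norm_num) (by norm_num) hj hj' hrow' ?_
      refine hX _ _ (hcX 10 j (by norm_num) (by norm_num) hj hj' (Or.inl hrow))
        (Or.inl (mem_hNbrs.2 ?_)) (hrow' 0 (by norm_num) (by norm_num))
      simp only [sub]; omega
    · refine hX.mem_upSet_of_row hc' (i₀ := 10) (by norm_num) (by norm_num) hj hj' hrow' ?_
      refine hX _ _ (hcX 0 j (by norm_num) (by norm_num) hj hj' (Or.inl hrow))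
        (Or.inl (mem_hNbrs.2 ?_)) (hrow' 10 (by norm_num) (by norm_num))
      simp only [sub]; omega
  · obtain ⟨a, ha⟩ := hc.exists_fullCol
    obtain ⟨a', ha'⟩ := hc'.exists_fullCol
    obtain ⟨i, hi, hi', hia, hia'⟩ := exists_outside_windows a a'
    have hcol := ha i hi hi' hia
    have hcol' := ha' i hi hi' hia'
    obtain ⟨h2, h1 | h1⟩ := mem_vNbrs.1 hn
    · refine hX.mem_upSet_of_col hc' (j₀ := 0) hi hi' (by norm_num) (by norm_num) hcol' ?_
      refine hX _ _ (hcX i 10 hi hi' (by norm_num) (by norm_num) (Or.inr hcol))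
        (Or.inr (mem_vNbrs.2 ?_)) (hcol' 0 (by norm_num) (by norm_num))
      simp only [sub]; omega
    · refine hX.mem_upSet_of_col hc' (j₀ := 10) hi hi' (by norm_num) (by norm_num) hcol' ?_
      refine hX _ _ (hcX i 0 hi hi' (by norm_num) (by norm_num) (Or.inr hcol))
        (Or.inr (mem_vNbrs.2 ?_)) (hcol' 10 (by norm_num) (by norm_num))
      simp only [sub]; omega

/-- The set of cells of level `n` obtained from a set `X` of cells of level zero by iterating
`upSet`. -/
def levelSet (g : ℤ × ℤ → Prop) (X : Set (ℤ × ℤ)) : ℕ → Set (ℤ × ℤ)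
  | 0 => X
  | n + 1 => upSet (Good g n) (levelSet g X n)

/-- All subcells of `c`, of its lower left subcell, of the lower left subcell of that one, and so
on down to level zero, are good. -/
def Chain (g : ℤ × ℤ → Prop) : ℕ → ℤ × ℤ → Prop
  | 0, c => g c
  | n + 1, c => (∀ i j : ℤ, 0 ≤ i → i < 11 → 0 ≤ j → j < 11 → Good g n (sub c i j)) ∧
      Chain g n (sub c 0 0)

variable {g g' : ℤ × ℤ → Prop}

lemma Spread.levelSet (hX : Spread g X) : ∀ n, Spread (Good g n) (levelSet g X n)
  | 0 => hX
  | n + 1 => (Spread.levelSet hX n).up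

/-- The lower left cell of level zero in the cell `c` of level `n`. -/
def corner (n : ℕ) (c : ℤ × ℤ) : ℤ × ℤ := (11 ^ n * c.1, 11 ^ n * c.2)

lemma corner_zero (c : ℤ × ℤ) : corner 0 c = c := by simp [corner]

lemma corner_sub (n : ℕ) (c : ℤ × ℤ) : corner n (sub c 0 0) = corner (n + 1) c := by
  simp only [corner, sub, Prod.mk.injEq]
  constructor <;> ring

/-- Along a good chain, filling climbs from the corner to the cell itself. -/
lemma Chain.mem_levelSet (hX : Spread g X) : ∀ {n : ℕ} {c : ℤ × ℤ}, Chain g n c →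
    corner n c ∈ X → c ∈ TwoStage.levelSet g X n
  | 0, c, _, h0 => by rwa [corner_zero] at h0
  | n + 1, c, hc, h0 => by
    rw [← corner_sub] at h0
    have h1 := Chain.mem_levelSet hX hc.2 h0
    refine (hX.levelSet n).mem_upSet_of_row (i₀ := 0) (j₀ := 0) ?_ le_rfl (by norm_num) le_rfl
      (by norm_num) (fun i hi hi' => hc.1 i 0 hi hi' le_rfl (by norm_num)) h1
    exact fun i j i' j' hi hi' hj hj' _ _ _ _ hb => absurd (hc.1 i j hi hi' hj hj') hb

/-- Along a good chain, filling descends from the cell to its corner. -/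
lemma Chain.corner_mem : ∀ {n : ℕ} {c : ℤ × ℤ}, Chain g n c →
    c ∈ TwoStage.levelSet g X n → corner n c ∈ X
  | 0, c, _, h0 => by rwa [corner_zero]
  | n + 1, c, hc, h0 => by
    rw [← corner_sub]
    refine Chain.corner_mem hc.2 (h0.2 0 0 le_rfl (by norm_num) le_rfl (by norm_num) (Or.inl ?_))
    exact fun i hi hi' => hc.1 i 0 hi hi' le_rfl (by norm_num)

/-- The cell `b` of level zero is contained in the cell `c` of level `n`. -/
def InCell (n : ℕ) (c b : ℤ × ℤ) : Prop :=
  11 ^ n * c.1 ≤ b.1 ∧ b.1 < 11 ^ n * c.1 + 11 ^ n ∧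
  11 ^ n * c.2 ≤ b.2 ∧ b.2 < 11 ^ n * c.2 + 11 ^ n

lemma inCell_zero {c b : ℤ × ℤ} : InCell 0 c b ↔ b = c := by
  simp only [InCell, Prod.ext_iff, pow_zero]; omega

lemma InCell.of_sub {n : ℕ} {c b : ℤ × ℤ} {i j : ℤ} (hi : 0 ≤ i) (hi' : i < 11) (hj : 0 ≤ j)
    (hj' : j < 11) (hb : InCell n (sub c i j) b) : InCell (n + 1) c b := by
  simp only [InCell, sub, pow_succ] at *
  have hp : (0 : ℤ) < 11 ^ n := by positivity
  obtain ⟨h1, h2, h3, h4⟩ := hb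
  refine ⟨?_, ?_, ?_, ?_⟩ <;> nlinarith

lemma inCell_corner (n : ℕ) (c : ℤ × ℤ) : InCell n c (corner n c) := by
  have hp : (0 : ℤ) < 11 ^ n := by positivity
  simp only [InCell, corner]
  omega

lemma Good.mono_on : ∀ {n : ℕ} {c : ℤ × ℤ}, (∀ b, InCell n c b → g b → g' b) →
    Good g n c → Good g' n c
  | 0, c, hg, hc => hg c (inCell_zero.2 rfl) hc
  | n + 1, c, hg, hc => by
    intro i j i' j' hi hi' hj hj' hk hk' hl hl' hb hb'
    refine hc i j i' j' hi hi' hj hj' hk hk' hl hl' (fun h1 => hb ?_) (fun h1 => hb' ?_)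
    · exact Good.mono_on (fun b hbc => hg b (hbc.of_sub hi hi' hj hj')) h1
    · exact Good.mono_on (fun b hbc => hg b (hbc.of_sub hk hk' hl hl')) h1

lemma Chain.mono_on : ∀ {n : ℕ} {c : ℤ × ℤ}, (∀ b, InCell n c b → g b → g' b) →
    Chain g n c → Chain g' n c
  | 0, c, hg, hc => hg c (inCell_zero.2 rfl) hc
  | n + 1, c, hg, hc =>
    ⟨fun i j hi hi' hj hj' => Good.mono_on (fun b hb => hg b (hb.of_sub hi hi' hj hj'))
      (hc.1 i j hi hi' hj hj'),
    Chain.mono_on (fun b hb => hg b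
      (hb.of_sub le_rfl (by norm_num) le_rfl (by norm_num))) hc.2⟩

/-- If the cells `(0,0), …, (M,0)` of level `n` are good and the chains of `(0,0)` and `(m,0)` are
good, then a spreading set containing the corner of `(m,0)` contains the origin. -/
lemma Spread.zero_mem (hX : Spread g X) {n : ℕ} {M m : ℤ} (hm : 0 ≤ m) (hmM : m ≤ M)
    (hgood : ∀ i : ℤ, 0 ≤ i → i ≤ M → Good g n (i, 0)) (h0 : Chain g n (0, 0))
    (hmc : Chain g n (m, 0)) (hmX : corner n (m, 0) ∈ X) : (0, 0) ∈ X := by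
  have hS := hX.levelSet n
  have hrow := interval_fill (f := fun i => ((i, 0) : ℤ × ℤ) ∈ TwoStage.levelSet g X n)
    (lo := 0) (hi := M + 1) (i₀ := m) (fun i hi hi' hn => ?_) hm (by omega)
    (hmc.mem_levelSet hX hmX) 0 le_rfl (by omega)
  · have := h0.corner_mem hrow
    simpa [corner] using this
  · rcases hn with hn | hn
    · exact hS _ _ hn (Or.inl (mem_hNbrs.2 (by simp))) (hgood i hi (by omega))
    · exact hS _ _ hn (Or.inl (mem_hNbrs.2 (by simp))) (hgood i hi (by omega))

end Hierarchy

/-! ### Growth of the state `1` in good boxes -/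

/-- The vertex `x` lies in the box of side `L` with index `b`. -/
def InBox (L : ℕ) (b x : ℤ × ℤ) : Prop :=
  (L * b.1 ≤ x.1 ∧ x.1 < L * b.1 + L) ∧ (L * b.2 ≤ x.2 ∧ x.2 < L * b.2 + L)

/-- The vertex with coordinates `(i, j)` relative to the lower left corner of the box `b`. -/
def site (L : ℕ) (b : ℤ × ℤ) (i j : ℤ) : ℤ × ℤ := (L * b.1 + i, L * b.2 + j)

/-- A box is good if there is no `2` in it or in one of the eight surrounding boxes, and each of its
rows and columns contains a `1`. -/
def BoxGood (L : ℕ) (ω : Config) (b : ℤ × ℤ) : Prop :=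
  (∀ x : ℤ × ℤ, L * b.1 - L ≤ x.1 → x.1 < L * b.1 + 2 * L →
    L * b.2 - L ≤ x.2 → x.2 < L * b.2 + 2 * L → ω x ≠ 2) ∧
  (∀ i : ℤ, 0 ≤ i → i < L → ∃ j : ℤ, 0 ≤ j ∧ j < L ∧ ω (site L b i j) = 1) ∧
  (∀ j : ℤ, 0 ≤ j → j < L → ∃ i : ℤ, 0 ≤ i ∧ i < L ∧ ω (site L b i j) = 1)

/-- The event on the `j`-th hook (the sites with maximal coordinate `j`) of the box `b`: it contains
no `2`, and either its corner or both of its arms contain a `1`. -/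
def Hook (L : ℕ) (ω : Config) (b : ℤ × ℤ) (j : ℤ) : Prop :=
  (∀ i, 0 ≤ i → i ≤ j → ω (site L b i j) ≠ 2 ∧ ω (site L b j i) ≠ 2) ∧
  (ω (site L b j j) = 1 ∨
    ((∃ i, 0 ≤ i ∧ i < j ∧ ω (site L b i j) = 1) ∧ ∃ i, 0 ≤ i ∧ i < j ∧ ω (site L b j i) = 1))

/-- A box is a nucleus if the hook events hold on all of its hooks. -/
def Nucleus (L : ℕ) (ω : Config) (b : ℤ × ℤ) : Prop := ∀ j : ℤ, 0 ≤ j → j < L → Hook L ω b j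

/-- Within `G`, the set `Z` is stable under the modified two-neighbour rule. -/
def FillClosed (G Z : Set (ℤ × ℤ)) : Prop :=
  ∀ x ∈ G, (∃ y ∈ hNbrs x, y ∈ Z) → (∃ y ∈ vNbrs x, y ∈ Z) → x ∈ Z

lemma FillClosed.site_mem {G Z : Set (ℤ × ℤ)} (hZ : FillClosed G Z) {L : ℕ} {b : ℤ × ℤ} {i j : ℤ}
    (hG : site L b i j ∈ G) (hh : site L b (i - 1) j ∈ Z ∨ site L b (i + 1) j ∈ Z)
    (hv : site L b i (j - 1) ∈ Z ∨ site L b i (j + 1) ∈ Z) : site L b i j ∈ Z := by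
  refine hZ _ hG ?_ ?_
  · rcases hh with hh | hh <;>
      exact ⟨_, mem_hNbrs.2 ⟨by simp [site], by simp only [site]; omega⟩, hh⟩
  · rcases hv with hv | hv <;>
      exact ⟨_, mem_vNbrs.2 ⟨by simp [site], by simp only [site]; omega⟩, hv⟩

/-- The hooks of a nucleus are filled one after the other. -/
lemma FillClosed.nucleus {G Z : Set (ℤ × ℤ)} (hZ : FillClosed G Z) {L : ℕ} {b : ℤ × ℤ}
    {ω : Config} (hω : ∀ x ∈ G, ω x = 1 → x ∈ Z) (hG : ∀ x, InBox L b x → x ∈ G)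
    (hN : Nucleus L ω b) : ∀ x, InBox L b x → x ∈ Z := by
  have hsG : ∀ i j : ℤ, 0 ≤ i → i < L → 0 ≤ j → j < L → site L b i j ∈ G := by
    intro i j h1 h2 h3 h4
    exact hG _ (by simp only [InBox, site]; omega)
  have main : ∀ k : ℕ, k ≤ L → ∀ i j : ℤ, 0 ≤ i → i < k → 0 ≤ j → j < k → site L b i j ∈ Z := by
    intro k
    induction k with
    | zero => intro _ i j h1 h2; push_cast at h2; omega
    | succ k ih =>
      intro hk
      have ih' := ih (by omega)
      have hkL : (k : ℤ) < L := by omega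
      have hone : ∀ i j : ℤ, 0 ≤ i → i < L → 0 ≤ j → j < L → ω (site L b i j) = 1 →
          site L b i j ∈ Z := fun i j h1 h2 h3 h4 h5 => hω _ (hsG i j h1 h2 h3 h4) h5
      have rowstep : ∀ i : ℤ, 0 ≤ i → i < k → (site L b (i - 1) k ∈ Z ∨ site L b (i + 1) k ∈ Z) →
          site L b i k ∈ Z := fun i h1 h2 hn =>
        hZ.site_mem (hsG i k h1 (by omega) (by omega) hkL) hn
          (Or.inl (ih' i (k - 1) h1 h2 (by omega) (by omega)))
      have colstep : ∀ i : ℤ, 0 ≤ i → i < k → (site L b k (i - 1) ∈ Z ∨ site L b k (i + 1) ∈ Z) →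
          site L b k i ∈ Z := fun i h1 h2 hn =>
        hZ.site_mem (hsG k i (by omega) hkL h1 (by omega))
          (Or.inl (ih' (k - 1) i (by omega) (by omega) h1 h2)) hn
      have hrc : (∀ i : ℤ, 0 ≤ i → i < k + 1 → site L b i k ∈ Z) ∧
          (∀ i : ℤ, 0 ≤ i → i < k + 1 → site L b k i ∈ Z) := by
        rcases (hN k (by omega) hkL).2 with hc | ⟨⟨i, hi, hik, hi1⟩, ⟨j, hj, hjk, hj1⟩⟩
        · have hkk := hone k k (by omega) hkL (by omega) hkL hc
          constructor
          · refine interval_fill (f := fun i => site L b i k ∈ Z) (i₀ := k) (fun i h1 h2 hn => ?_)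
              (by omega) (by omega) hkk
            rcases (show i < k ∨ i = k by omega) with h | rfl
            · exact rowstep i h1 h hn
            · exact hkk
          · refine interval_fill (f := fun i => site L b k i ∈ Z) (i₀ := k) (fun i h1 h2 hn => ?_)
              (by omega) (by omega) hkk
            rcases (show i < k ∨ i = k by omega) with h | rfl
            · exact colstep i h1 h hn
            · exact hkk
        · have hr := interval_fill (f := fun i => site L b i k ∈ Z) rowstep hi hik
            (hone i k hi (by omega) (by omega) hkL hi1)
          have hc := interval_fill (f := fun i => site L b k i ∈ Z) colstep hj hjk
            (hone k j (by omega) hkL hj (by omega) hj1)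
          have hkk : site L b k k ∈ Z :=
            hZ.site_mem (hsG k k (by omega) hkL (by omega) hkL)
              (Or.inl (hr (k - 1) (by omega) (by omega)))
              (Or.inl (hc (k - 1) (by omega) (by omega)))
          constructor
          · intro i h1 h2
            rcases (show i < k ∨ i = k by omega) with h | rfl
            · exact hr i h1 h
            · exact hkk
          · intro i h1 h2
            rcases (show i < k ∨ i = k by omega) with h | rfl
            · exact hc i h1 h
            · exact hkk
      intro i j h1 h2 h3 h4
      push_cast at h2 h4
      rcases (show j < k ∨ j = k by omega) with h | rfl
      · rcases (show i < k ∨ i = k by omega) with h' | rfl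
        · exact ih' i j h1 h' h3 h
        · exact hrc.2 j h3 h4
      · exact hrc.1 i h1 h2
  intro x hx
  have hx' := main L le_rfl (x.1 - L * b.1) (x.2 - L * b.2) (by unfold InBox at hx; omega)
    (by unfold InBox at hx; omega) (by unfold InBox at hx; omega) (by unfold InBox at hx; omega)
  simpa [site] using hx'

/-- A rectangle whose columns each contain an occupied vertex fills up column by column once the
column next to it is occupied. -/
lemma sweep {F : ℤ → ℤ → Prop} {L : ℤ}
    (hstep : ∀ i j, 0 ≤ i → i < L → 0 ≤ j → j < L → (F (i - 1) j ∨ F (i + 1) j) →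
      (F i (j - 1) ∨ F i (j + 1)) → F i j)
    (hcol : ∀ i, 0 ≤ i → i < L → ∃ j, 0 ≤ j ∧ j < L ∧ F i j)
    (h0 : ∀ j, 0 ≤ j → j < L → F (-1) j) :
    ∀ i j, 0 ≤ i → i < L → 0 ≤ j → j < L → F i j := by
  have main : ∀ k : ℕ, (k : ℤ) ≤ L → ∀ j, 0 ≤ j → j < L → F (k - 1) j := by
    intro k
    induction k with
    | zero => intro _ j h1 h2; simpa using h0 j h1 h2
    | succ k ih =>
      intro hk
      push_cast at hk
      obtain ⟨j, hj, hj', hjF⟩ := hcol k (by omega) (by omega)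
      have := interval_fill (f := fun j => F k j)
        (fun j h1 h2 hn => hstep k j (by omega) (by omega) h1 h2
          (Or.inl (ih (by omega) j h1 h2)) hn) hj hj' hjF
      intro j h1 h2
      have := this j h1 h2
      simpa using this
  intro i j h1 h2 h3 h4
  have := main (i + 1).toNat (by omega) j h3 h4
  rwa [show (((i + 1).toNat : ℕ) : ℤ) - 1 = i by omega] at this

/-- A filled box fills every adjacent good box. -/
lemma FillClosed.spread {G Z : Set (ℤ × ℤ)} (hZ : FillClosed G Z) {L : ℕ} {ω : Config}
    (hω : ∀ x ∈ G, ω x = 1 → x ∈ Z) {g : ℤ × ℤ → Prop} (hg : ∀ b, g b → BoxGood L ω b)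
    (hG : ∀ b, g b → ∀ x, InBox L b x → x ∈ G) :
    Spread g {b | ∀ x, InBox L b x → x ∈ Z} := by
  intro b b' hb hn hb'
  change ∀ x, InBox L b x → x ∈ Z at hb
  change ∀ x, InBox L b' x → x ∈ Z
  have hsG : ∀ i j : ℤ, 0 ≤ i → i < L → 0 ≤ j → j < L → site L b' i j ∈ G := by
    intro i j h1 h2 h3 h4
    exact hG b' hb' _ (by simp only [InBox, site]; omega)
  have hcol : ∀ i : ℤ, 0 ≤ i → i < L → ∃ j : ℤ, 0 ≤ j ∧ j < L ∧ site L b' i j ∈ Z := by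
    intro i h1 h2
    obtain ⟨j, h3, h4, h5⟩ := (hg b' hb').2.1 i h1 h2
    exact ⟨j, h3, h4, hω _ (hsG i j h1 h2 h3 h4) h5⟩
  have hrow : ∀ j : ℤ, 0 ≤ j → j < L → ∃ i : ℤ, 0 ≤ i ∧ i < L ∧ site L b' i j ∈ Z := by
    intro j h1 h2
    obtain ⟨i, h3, h4, h5⟩ := (hg b' hb').2.2 j h1 h2
    exact ⟨i, h3, h4, hω _ (hsG i j h3 h4 h1 h2) h5⟩
  have hex1 : (L : ℤ) * (b.1 + 1) = L * b.1 + L := by ring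
  have hex2 : (L : ℤ) * (b.1 - 1) = L * b.1 - L := by ring
  have hey1 : (L : ℤ) * (b.2 + 1) = L * b.2 + L := by ring
  have hey2 : (L : ℤ) * (b.2 - 1) = L * b.2 - L := by ring
  suffices hall : ∀ i j : ℤ, 0 ≤ i → i < L → 0 ≤ j → j < L → site L b' i j ∈ Z by
    intro x hx
    have := hall (x.1 - L * b'.1) (x.2 - L * b'.2) (by unfold InBox at hx; omega)
      (by unfold InBox at hx; omega) (by unfold InBox at hx; omega) (by unfold InBox at hx; omega)
    simpa [site] using this
  rcases hn with hn | hn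
  · obtain ⟨e2, e1 | e1⟩ := mem_hNbrs.1 hn
    · refine sweep (fun i j h1 h2 h3 h4 => hZ.site_mem (hsG i j h1 h2 h3 h4)) hcol ?_
      intro j h1 h2
      refine hb _ ?_
      simp only [InBox, site, e1, e2, hex1]; omega
    · have hs := sweep (F := fun i j => site L b' (L - 1 - i) j ∈ Z) (L := L) ?_ ?_ ?_
      · intro i j h1 h2 h3 h4
        have := hs (L - 1 - i) j (by omega) (by omega) h3 h4
        rwa [show (L : ℤ) - 1 - (L - 1 - i) = i by ring] at this
      · intro i j h1 h2 h3 h4 hh hv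
        refine hZ.site_mem (hsG _ j (by omega) (by omega) h3 h4) ?_ hv
        rw [show (L : ℤ) - 1 - i - 1 = L - 1 - (i + 1) by ring,
          show (L : ℤ) - 1 - i + 1 = L - 1 - (i - 1) by ring]
        exact hh.symm
      · exact fun i h1 h2 => hcol (L - 1 - i) (by omega) (by omega)
      · intro j h1 h2
        refine hb _ ?_
        simp only [InBox, site, e1, e2, hex2]; omega
  · obtain ⟨e2, e1 | e1⟩ := mem_vNbrs.1 hn
    · have hs := sweep (F := fun i j => site L b' j i ∈ Z) (L := L) ?_ ?_ ?_
      · exact fun i j h1 h2 h3 h4 => hs j i h3 h4 h1 h2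
      · exact fun i j h1 h2 h3 h4 hh hv => hZ.site_mem (hsG j i h3 h4 h1 h2) hv hh
      · exact fun i h1 h2 => hrow i h1 h2
      · intro j h1 h2
        refine hb _ ?_
        simp only [InBox, site, e1, e2, hey1]; omega
    · have hs := sweep (F := fun i j => site L b' j (L - 1 - i) ∈ Z) (L := L) ?_ ?_ ?_
      · intro i j h1 h2 h3 h4
        have := hs (L - 1 - j) i (by omega) (by omega) h1 h2
        rwa [show (L : ℤ) - 1 - (L - 1 - j) = j by ring] at this
      · intro i j h1 h2 h3 h4 hh hv
        refine hZ.site_mem (hsG j _ h3 h4 (by omega) (by omega)) hv ?_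
        rw [show (L : ℤ) - 1 - i - 1 = L - 1 - (i + 1) by ring,
          show (L : ℤ) - 1 - i + 1 = L - 1 - (i - 1) by ring]
        exact hh.symm
      · exact fun i h1 h2 => hrow (L - 1 - i) (by omega) (by omega)
      · intro j h1 h2
        refine hb _ ?_
        simp only [InBox, site, e1, e2, hey2]; omega

/-! ### Time control -/

open Classical in
/-- The modified bootstrap percolation process restricted to the finite set `G`, started from the
initial `1`s in `G`. -/
noncomputable def fillTime (G : Finset (ℤ × ℤ)) (ω : Config) : ℕ → Finset (ℤ × ℤ)
  | 0 => G.filter fun x => ω x = 1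
  | t + 1 => fillTime G ω t ∪
      G.filter fun x => (∃ y ∈ hNbrs x, y ∈ fillTime G ω t) ∧ ∃ y ∈ vNbrs x, y ∈ fillTime G ω t

lemma fillTime_subset (G : Finset (ℤ × ℤ)) (ω : Config) : ∀ t, fillTime G ω t ⊆ G
  | 0 => Finset.filter_subset _ _
  | t + 1 => Finset.union_subset (fillTime_subset G ω t) (Finset.filter_subset _ _)

lemma fillTime_mono (G : Finset (ℤ × ℤ)) (ω : Config) : Monotone (fillTime G ω) :=
  monotone_nat_of_le_succ fun _ => Finset.subset_union_left

/-- The restricted process stops growing by time `|G|`, because it adds a vertex of `G` in every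
step before. -/
lemma exists_fillTime_eq (G : Finset (ℤ × ℤ)) (ω : Config) :
    ∃ t ≤ G.card, fillTime G ω (t + 1) = fillTime G ω t := by
  by_contra hcon
  push Not at hcon
  have hc : ∀ t ≤ G.card + 1, t ≤ (fillTime G ω t).card := by
    intro t
    induction t with
    | zero => simp
    | succ t ih =>
      intro ht
      have h1 := ih (by omega)
      have h2 : fillTime G ω t ⊂ fillTime G ω (t + 1) :=
        Finset.ssubset_iff_subset_ne.2
          ⟨fillTime_mono G ω (Nat.le_succ t), (hcon t (by omega)).symm⟩
      have := Finset.card_lt_card h2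
      omega
  have h1 := hc (G.card + 1) le_rfl
  have h2 := Finset.card_le_card (fillTime_subset G ω (G.card + 1))
  omega

lemma step_eq_one_of_zero {v : Variant} {ξ : Config} {x : ℤ × ℤ} (h0 : ξ x = 0)
    (hh : ∃ y ∈ hNbrs x, ξ y = 1) (hv : ∃ y ∈ vNbrs x, ξ y = 1) : step v ξ x = 1 := by
  have h1 : 1 ≤ numH 1 ξ x := by
    obtain ⟨y, hy, hy1⟩ := hh
    exact Finset.card_pos.2 ⟨y, Finset.mem_filter.2 ⟨hy, hy1⟩⟩
  have h2 : 1 ≤ numV 1 ξ x := by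
    obtain ⟨y, hy, hy1⟩ := hv
    exact Finset.card_pos.2 ⟨y, Finset.mem_filter.2 ⟨hy, hy1⟩⟩
  have h3 : 2 ≤ v.count ξ x := by
    cases v
    · simp only [Variant.count, num]; omega
    · simp [Variant.count, numDir, h1, h2]
  simp [step, h0, h3]

lemma step_eq_one_of_one {v : Variant} {ξ : Config} {x : ℤ × ℤ} (h1 : ξ x = 1)
    (h2 : step v ξ x ≠ 2) : step v ξ x = 1 := by
  unfold step at *
  rw [if_neg (by rw [h1]; decide), if_pos h1] at *
  split_ifs at * <;> simp_all

lemma step_ne_zero {v : Variant} {ξ : Config} {x : ℤ × ℤ} (h : ξ x ≠ 0) : step v ξ x ≠ 0 := by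
  unfold step
  rw [if_neg h]
  split_ifs <;> decide

/-- As long as `G` is free of `2`s, the vertices of the restricted process are in state `1`. -/
lemma evolve_eq_one {v : Variant} {ω : Config} {G : Finset (ℤ × ℤ)} {T : ℕ}
    (hG : ∀ t ≤ T, ∀ x ∈ G, evolve v ω t x ≠ 2) :
    ∀ t ≤ T, ∀ x ∈ fillTime G ω t, evolve v ω t x = 1 := by
  intro t
  induction t with
  | zero => intro _ x hx; exact (Finset.mem_filter.1 hx).2
  | succ t ih =>
    intro ht x hx
    have ih' := ih (by omega)
    have hxG := fillTime_subset G ω _ hx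
    have hx2 := hG (t + 1) ht x hxG
    rcases Finset.mem_union.1 hx with hx | hx
    · exact step_eq_one_of_one (ih' x hx) hx2
    · obtain ⟨-, ⟨y, hy, hyf⟩, ⟨z, hz, hzf⟩⟩ := Finset.mem_filter.1 hx
      have hxt := hG t (by omega) x hxG
      have h01 : evolve v ω t x = 0 ∨ evolve v ω t x = 1 := by omega
      rcases h01 with h0 | h1
      · exact step_eq_one_of_zero h0 ⟨y, hy, ih' y hyf⟩ ⟨z, hz, ih' z hzf⟩
      · exact step_eq_one_of_one h1 hx2

lemma mem_originLeavesZero {v : Variant} {ω : Config} {t : ℕ} (h : evolve v ω t (0, 0) ≠ 0) :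
    ω ∈ originLeavesZero v := by
  refine eventually_atTop.2 ⟨t, fun s hs => ?_⟩
  induction s, hs using Nat.le_induction with
  | base => exact h
  | succ s _ ih => exact step_ne_zero ih

/-- No square of side `2L` with lower left corner in `[-T, 2T]²` contains more than `L / 2`
initial `2`s. -/
def NoDenseSquare (L T : ℕ) (ω : Config) : Prop :=
  ∀ a : ℤ × ℤ, (-(T : ℤ), -(T : ℤ)) ≤ a → a ≤ (2 * (T : ℤ), 2 * (T : ℤ)) →
    2 * ((Finset.Icc a (a + (2 * (L : ℤ), 2 * (L : ℤ)))).filter fun x => ω x = 2).card ≤ L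

/-- If there are no dense squares, the `2`s do not enter good boxes in `[0, T)²` up to time `T`. -/
lemma NoDenseSquare.evolve_ne_two {v : Variant} {L T : ℕ} {ω : Config} (hL : 2 ≤ L)
    (hd : NoDenseSquare L T ω) {b x : ℤ × ℤ} (hb : BoxGood L ω b) (hx : InBox L b x)
    (hx1 : 0 ≤ x.1 ∧ x.1 < T) (hx2 : 0 ≤ x.2 ∧ x.2 < T) {t : ℕ} (ht : t ≤ T) :
    evolve v ω t x ≠ 2 := by
  intro h2
  classical
  set lo : ℤ × ℤ := (-(T : ℤ), -(T : ℤ)) with hlo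
  set hi : ℤ × ℤ := (2 * (T : ℤ), 2 * (T : ℤ)) with hhi
  set A : Finset (ℤ × ℤ) := (Finset.Icc lo hi).filter fun x => ω x = 2 with hA
  obtain ⟨X, hX, hAX, hXA⟩ := exists_twoClosed (A := A) (lo := lo) (hi := hi) hL
    (fun x hx => Finset.mem_Icc.1 (Finset.mem_filter.1 hx).1) (by
      intro a h1 h3
      refine le_trans ?_ (hd a h1 h3)
      refine Nat.mul_le_mul_left 2 (Finset.card_le_card fun y hy => ?_)
      simp only [hA, Finset.mem_filter, Finset.mem_Icc] at hy ⊢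
      exact ⟨hy.2, hy.1.2⟩)
  have hxX : x ∈ X := by
    refine mem_of_evolve_eq_two hX t x (fun y h1 h3 hy => hAX y ?_) h2
    rw [abs_le] at h1 h3
    refine Finset.mem_filter.2 ⟨Finset.mem_Icc.2 ⟨⟨?_, ?_⟩, ⟨?_, ?_⟩⟩, hy⟩ <;>
      simp only [hlo, hhi] <;> omega
  obtain ⟨y, hy, h1, h3⟩ := hXA x hxX
  rw [abs_lt] at h1 h3
  unfold InBox at hx
  exact hb.1 y (by omega) (by omega) (by omega) (by omega) (Finset.mem_filter.1 hy).2

/-- The deterministic part of the proof. On these events, the `1`s spread from the nucleus to the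
origin, along good boxes, before the `2`s can interfere. -/
theorem mem_originLeavesZero_of_nucleus {v : Variant} {ω : Config} {L n M T : ℕ} (hL : 2 ≤ L)
    (hT : (L * (11 ^ n * (M + 1))) ^ 2 ≤ T) (hd : NoDenseSquare L T ω) {m : ℤ} (hm : 0 ≤ m)
    (hmM : m ≤ M) (hgood : ∀ i : ℤ, 0 ≤ i → i ≤ M → Good (BoxGood L ω) n (i, 0))
    (h0 : Chain (BoxGood L ω) n (0, 0)) (hmc : Chain (BoxGood L ω) n (m, 0))
    (hN : Nucleus L ω (corner n (m, 0))) : ω ∈ originLeavesZero v := by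
  classical
  set R : ℕ := 11 ^ n * (M + 1) with hR
  set g : ℤ × ℤ → Prop := fun b => BoxGood L ω b ∧ (0 ≤ b.1 ∧ b.1 < R) ∧ (0 ≤ b.2 ∧ b.2 < R)
    with hg
  set S : Finset (ℤ × ℤ) := Finset.Ico (0 : ℤ) (L * R) ×ˢ Finset.Ico (0 : ℤ) (L * R) with hS
  set G : Finset (ℤ × ℤ) := S.filter fun x => ∃ b, g b ∧ InBox L b x with hGdef
  have hGT : G.card ≤ T := by
    refine le_trans (Finset.card_filter_le _ _) (le_trans (le_of_eq ?_) hT)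
    simp only [hS, Finset.card_product, Int.card_Ico, sub_zero]
    rw [← Nat.cast_mul, Int.toNat_natCast, sq]
  have hLRT : (L * R : ℤ) ≤ T := by
    have h1 : L * R ≤ (L * R) ^ 2 := Nat.le_self_pow two_ne_zero _
    exact_mod_cast h1.trans hT
  have hG2 : ∀ t ≤ T, ∀ x ∈ G, evolve v ω t x ≠ 2 := by
    intro t ht x hx
    obtain ⟨hxS, b, hb, hbx⟩ := Finset.mem_filter.1 hx
    simp only [hS, Finset.mem_product, Finset.mem_Ico] at hxS
    exact hd.evolve_ne_two hL hb.1 hbx (by omega) (by omega) ht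
  -- Once the restricted process is stable, the spreading of boxes becomes a static question.
  obtain ⟨t, ht, hstab⟩ := exists_fillTime_eq G ω
  set Z : Set (ℤ × ℤ) := {x | x ∈ fillTime G ω t} with hZdef
  have hZ : FillClosed {x | x ∈ G} Z := by
    intro x hx hh hv
    change x ∈ fillTime G ω t
    rw [← hstab]
    exact Finset.mem_union_right _ (Finset.mem_filter.2 ⟨hx, hh, hv⟩)
  have hω : ∀ x ∈ {x | x ∈ G}, ω x = 1 → x ∈ Z := fun x hx h1 =>
    fillTime_mono G ω (Nat.zero_le t) (Finset.mem_filter.2 ⟨hx, h1⟩)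
  have hboxG : ∀ b, g b → ∀ x, InBox L b x → x ∈ {x | x ∈ G} := by
    intro b hb x hx
    refine Finset.mem_filter.2 ⟨?_, b, hb, hx⟩
    simp only [hS, Finset.mem_product, Finset.mem_Ico]
    obtain ⟨-, ⟨h1, h2⟩, h3, h4⟩ := hb
    obtain ⟨⟨k1, k2⟩, k3, k4⟩ := hx
    have hLpos : (0 : ℤ) < L := by omega
    refine ⟨⟨?_, ?_⟩, ?_, ?_⟩ <;> nlinarith
  have hspread : Spread g {b | ∀ x, InBox L b x → x ∈ Z} :=
    hZ.spread hω (fun b hb => hb.1) hboxG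
  have hreg : ∀ i : ℤ, 0 ≤ i → i ≤ M → ∀ b, InCell n (i, 0) b → BoxGood L ω b → g b := by
    intro i h1 h2 b hb hgb
    have hp : (0 : ℤ) < 11 ^ n := by positivity
    have hRc : (R : ℤ) = 11 ^ n * (M + 1) := by rw [hR]; push_cast; ring
    simp only [InCell] at hb
    refine ⟨hgb, ⟨?_, ?_⟩, ?_, ?_⟩ <;> (try rw [hRc]) <;> nlinarith
  have hNg : g (corner n (m, 0)) := by
    refine hreg m hm hmM _ (inCell_corner n _) ?_
    -- The lower left box at the bottom of a chain is good.
    have hbase : ∀ (k : ℕ) (c : ℤ × ℤ), Chain (BoxGood L ω) k c → BoxGood L ω (corner k c) := by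
      intro k
      induction k with
      | zero => intro c hc; rw [corner_zero]; exact hc
      | succ k ih => intro c hc; rw [← corner_sub]; exact ih _ hc.2
    exact hbase n _ hmc
  have hzero := hspread.zero_mem (n := n) hm hmM
    (fun i h1 h2 => (hgood i h1 h2).mono_on (hreg i h1 h2))
    (h0.mono_on (hreg 0 le_rfl (by omega))) (hmc.mono_on (hreg m hm hmM))
    (hZ.nucleus hω (hboxG _ hNg) hN)
  have h00 : ((0, 0) : ℤ × ℤ) ∈ Z := hzero _ (by simp [InBox]; omega)
  refine mem_originLeavesZero (t := t) ?_
  rw [evolve_eq_one hG2 t (ht.trans hGT) _ h00]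
  decide

/-! ### Events depending on finitely many vertices -/

lemma isProbabilityMeasure_siteLaw {p q : ℝ} (hp : 0 ≤ p) (hq : 0 ≤ q) (hpq : p + q ≤ 1) :
    IsProbabilityMeasure (siteLaw p q) := by
  constructor
  simp only [siteLaw, Measure.coe_add, Measure.coe_smul, Pi.add_apply, Pi.smul_apply,
    measure_univ, smul_eq_mul, mul_one]
  rw [← ENNReal.ofReal_add (by linarith) hp, ← ENNReal.ofReal_add (by linarith) hq]
  simp [show 1 - p - q + p + q = 1 by ring]

lemma siteLaw_real_one {p q : ℝ} (hp : 0 ≤ p) : (siteLaw p q).real {1} = p := by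
  simp [siteLaw, measureReal_def, hp]

lemma siteLaw_real_two {p q : ℝ} (hq : 0 ≤ q) : (siteLaw p q).real {2} = q := by
  simp [siteLaw, measureReal_def, hq]

lemma BoxGood.congr {L : ℕ} {ω ω' : Config} {b : ℤ × ℤ}
    (h : ∀ x : ℤ × ℤ, L * b.1 - L ≤ x.1 → x.1 < L * b.1 + 2 * L →
    L * b.2 - L ≤ x.2 → x.2 < L * b.2 + 2 * L → ω x = ω' x) (hb : BoxGood L ω b) :
    BoxGood L ω' b := by
  have hsite : ∀ i j : ℤ, 0 ≤ i → i < L → 0 ≤ j → j < L → ω (site L b i j) = ω' (site L b i j) := by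
    intro i j h1 h2 h3 h4
    apply h <;> simp only [site] <;> omega
  refine ⟨fun x k1 k2 k3 k4 => h x k1 k2 k3 k4 ▸ hb.1 x k1 k2 k3 k4, fun i k1 k2 => ?_,
    fun j k1 k2 => ?_⟩
  · obtain ⟨j, k3, k4, k5⟩ := hb.2.1 i k1 k2
    exact ⟨j, k3, k4, hsite i j k1 k2 k3 k4 ▸ k5⟩
  · obtain ⟨i, k3, k4, k5⟩ := hb.2.2 j k1 k2
    exact ⟨i, k3, k4, hsite i j k3 k4 k1 k2 ▸ k5⟩

/-- The vertices in the boxes of the cell `c` of level `n` and in the boxes adjacent to these. -/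
noncomputable def cellSites (L n : ℕ) (c : ℤ × ℤ) : Finset (ℤ × ℤ) :=
  Finset.Ico (L * (11 ^ n * c.1) - L) (L * (11 ^ n * c.1 + 11 ^ n) + L) ×ˢ
    Finset.Ico (L * (11 ^ n * c.2) - L) (L * (11 ^ n * c.2 + 11 ^ n) + L)

lemma dependsOn_of_imp {E : Set Config} {S : Set (ℤ × ℤ)}
    (h : ∀ ω ω' : Config, (∀ x ∈ S, ω x = ω' x) → ω ∈ E → ω' ∈ E) : DependsOn (· ∈ E) S :=
  fun ω ω' hS => propext ⟨h ω ω' hS, h ω' ω fun x hx => (hS x hx).symm⟩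

lemma dependsOn_inter {E F : Set Config} {S T : Set (ℤ × ℤ)} (hE : DependsOn (· ∈ E) S)
    (hF : DependsOn (· ∈ F) T) : DependsOn (· ∈ E ∩ F) (S ∪ T) :=
  dependsOn_of_imp fun _ _ h hω =>
    ⟨(eq_iff_iff.1 (hE fun x hx => h x (Or.inl hx))).1 hω.1,
      (eq_iff_iff.1 (hF fun x hx => h x (Or.inr hx))).1 hω.2⟩

lemma dependsOn_compl {E : Set Config} {S : Set (ℤ × ℤ)} (hE : DependsOn (· ∈ E) S) :
    DependsOn (· ∈ Eᶜ) S :=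
  dependsOn_of_imp fun _ _ h hω hω' => hω ((eq_iff_iff.1 (hE fun x hx => h x hx)).2 hω')

lemma BoxGood.congr_cell {L n : ℕ} {c b : ℤ × ℤ} {ω ω' : Config} (hb : InCell n c b)
    (h : ∀ x ∈ cellSites L n c, ω x = ω' x) : BoxGood L ω b → BoxGood L ω' b := by
  refine BoxGood.congr fun x h1 h2 h3 h4 => h x ?_
  obtain ⟨k1, k2, k3, k4⟩ := hb
  have hL : (0 : ℤ) ≤ L := Int.natCast_nonneg L
  have m1 := mul_le_mul_of_nonneg_left k1 hL
  have m2 := mul_le_mul_of_nonneg_left (Int.add_one_le_of_lt k2) hL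
  have m3 := mul_le_mul_of_nonneg_left k3 hL
  have m4 := mul_le_mul_of_nonneg_left (Int.add_one_le_of_lt k4) hL
  have m5 : (L : ℤ) * (b.1 + 1) = L * b.1 + L := by ring
  have m6 : (L : ℤ) * (b.2 + 1) = L * b.2 + L := by ring
  simp only [cellSites, Finset.mem_product, Finset.mem_Ico]
  refine ⟨⟨?_, ?_⟩, ?_, ?_⟩ <;> linarith

lemma dependsOn_good (L n : ℕ) (c : ℤ × ℤ) :
    DependsOn (· ∈ {ω : Config | Good (BoxGood L ω) n c}) (cellSites L n c : Set (ℤ × ℤ)) :=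
  dependsOn_of_imp fun _ _ h hω => hω.mono_on fun _ hb => BoxGood.congr_cell hb h

lemma dependsOn_chain (L n : ℕ) (c : ℤ × ℤ) :
    DependsOn (· ∈ {ω : Config | Chain (BoxGood L ω) n c}) (cellSites L n c : Set (ℤ × ℤ)) :=
  dependsOn_of_imp fun _ _ h hω => hω.mono_on fun _ hb => BoxGood.congr_cell hb h

/-- The sites of a cell include a margin of one box, which does not matter for cells at distance at
least three. -/
lemma disjoint_cellSites {L n : ℕ} {c c' : ℤ × ℤ} (h : ¬ (|c.1 - c'.1| ≤ 2 ∧ |c.2 - c'.2| ≤ 2)) :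
    Disjoint (cellSites L n c) (cellSites L n c') := by
  have key : ∀ a b : ℤ, a + 3 ≤ b →
      (L : ℤ) * (11 ^ n * a + 11 ^ n) + L ≤ L * (11 ^ n * b) - L := by
    intro a b hab
    have hp : (1 : ℤ) ≤ 11 ^ n := one_le_pow₀ (by norm_num)
    have hL : (0 : ℤ) ≤ L := Int.natCast_nonneg L
    have h1 : (11 : ℤ) ^ n * (a + 3) ≤ 11 ^ n * b := by gcongr
    have h2 : (L : ℤ) * (11 ^ n * a + 11 ^ n + 2) ≤ L * (11 ^ n * b) :=
      mul_le_mul_of_nonneg_left (by linarith) hL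
    linarith
  rw [Finset.disjoint_left]
  intro x hx hx'
  simp only [cellSites, Finset.mem_product, Finset.mem_Ico] at hx hx'
  apply h
  simp only [abs_le]
  by_contra hcon
  rcases (show c.1 + 3 ≤ c'.1 ∨ c'.1 + 3 ≤ c.1 ∨ c.2 + 3 ≤ c'.2 ∨ c'.2 + 3 ≤ c.2 by omega)
    with h | h | h | h <;> have := key _ _ h <;> linarith [hx.1.1, hx.1.2, hx.2.1, hx.2.2,
      hx'.1.1, hx'.1.2, hx'.2.1, hx'.2.2]

section Probability

variable {p q : ℝ} [IsProbabilityMeasure (siteLaw p q)]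

instance : IsProbabilityMeasure (initialLaw p q) := by
  unfold initialLaw; infer_instance

lemma measurableSet_of_dependsOn {E : Set Config} {S : Finset (ℤ × ℤ)}
    (hE : DependsOn (· ∈ E) (S : Set (ℤ × ℤ))) : MeasurableSet E := by
  have : E = S.restrict ⁻¹' {f | ∃ ω ∈ E, S.restrict ω = f} := by
    ext ω
    refine ⟨fun h => ⟨ω, h, rfl⟩, fun ⟨ω', h, h2⟩ => ?_⟩
    have := hE (x := ω') (y := ω) (fun i hi => congrFun h2 ⟨i, hi⟩)
    exact (eq_iff_iff.1 this).1 h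
  rw [this]
  exact (Finset.measurable_restrict S) (MeasurableSet.of_discrete)

/-- Events depending on disjoint finite sets of vertices are independent. -/
lemma prob_inter {E F : Set Config} {S T : Finset (ℤ × ℤ)}
    (hE : DependsOn (· ∈ E) (S : Set (ℤ × ℤ))) (hF : DependsOn (· ∈ F) (T : Set (ℤ × ℤ)))
    (hST : Disjoint S T) :
    (initialLaw p q).real (E ∩ F) = (initialLaw p q).real E * (initialLaw p q).real F := by
  have hind : ProbabilityTheory.iIndepFun (fun (i : ℤ × ℤ) (ω : Config) => ω i)
      (initialLaw p q) := by
    have := ProbabilityTheory.iIndepFun_infinitePi (P := fun _ : ℤ × ℤ => siteLaw p q)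
      (X := fun _ => id) (fun _ => measurable_id)
    exact this
  have h2 := hind.indepFun_finset S T hST (fun i => measurable_pi_apply i)
  have key : ∀ {E : Set Config} {S : Finset (ℤ × ℤ)},
      DependsOn (· ∈ E) (S : Set (ℤ × ℤ)) →
      E = (fun (a : Config) (i : S) => a i) ⁻¹' {f | ∃ ω ∈ E, S.restrict ω = f} := by
    intro E S hE
    ext ω
    refine ⟨fun h => ⟨ω, h, rfl⟩, fun ⟨ω', h, h2⟩ => ?_⟩
    have := hE (x := ω') (y := ω) (fun i hi => congrFun h2 ⟨i, hi⟩)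
    exact (eq_iff_iff.1 this).1 h
  rw [key hE, key hF, measureReal_def, h2.measure_inter_preimage_eq_mul _ _
    MeasurableSet.of_discrete MeasurableSet.of_discrete, ENNReal.toReal_mul]
  rfl

lemma prob_forall_mem (S : Finset (ℤ × ℤ)) (A : Set (Fin 3)) :
    (initialLaw p q).real {ω | ∀ x ∈ S, ω x ∈ A} = (siteLaw p q).real A ^ S.card := by
  have : {ω : Config | ∀ x ∈ S, ω x ∈ A} = Set.pi (S : Set (ℤ × ℤ)) fun _ => A := by
    ext; simp [Set.mem_pi]
  rw [this, measureReal_def, initialLaw, Measure.infinitePi_pi _ (fun _ _ => .of_discrete)]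
  simp [measureReal_def]

lemma prob_eq_one (hp : 0 ≤ p) (x : ℤ × ℤ) : (initialLaw p q).real {ω | ω x = 1} = p := by
  have := prob_forall_mem (p := p) (q := q) {x} {1}
  simpa [siteLaw_real_one hp] using this

lemma prob_forall_eq_two (hq : 0 ≤ q) (S : Finset (ℤ × ℤ)) :
    (initialLaw p q).real {ω | ∀ x ∈ S, ω x = 2} = q ^ S.card := by
  have := prob_forall_mem (p := p) (q := q) S {2}
  simpa [siteLaw_real_two hq] using this

lemma prob_forall_ne_one (hp : 0 ≤ p) (S : Finset (ℤ × ℤ)) :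
    (initialLaw p q).real {ω | ∀ x ∈ S, ω x ≠ 1} = (1 - p) ^ S.card := by
  have := prob_forall_mem (p := p) (q := q) S {1}ᶜ
  rw [measureReal_compl .of_discrete, siteLaw_real_one hp] at this
  simpa using this

lemma prob_exists_eq_two_le (hq : 0 ≤ q) (S : Finset (ℤ × ℤ)) :
    (initialLaw p q).real {ω | ∃ x ∈ S, ω x = 2} ≤ S.card * q := by
  have : {ω : Config | ∃ x ∈ S, ω x = 2} = ⋃ x ∈ S, {ω | ω x = 2} := by ext; simp
  rw [this]
  refine (measureReal_biUnion_finset_le _ _).trans ?_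
  have h1 : ∀ x ∈ S, (initialLaw p q).real {ω | ω x = 2} = q := fun x _ => by
    simpa using prob_forall_eq_two (p := p) hq {x}
  rw [Finset.sum_congr rfl h1]
  simp

/-! ### Bad boxes and bad cells are unlikely -/

/-- The first term bounds the probability of a `2` in the `3 × 3` block of boxes, the second one that
of a row or column without a `1`. -/
lemma prob_not_boxGood_le (hp : 0 ≤ p) (hq : 0 ≤ q) (L : ℕ) (b : ℤ × ℤ) :
    (initialLaw p q).real {ω | ¬ BoxGood L ω b} ≤ 9 * L ^ 2 * q + 2 * L * (1 - p) ^ L := by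
  set S : Finset (ℤ × ℤ) := Finset.Ico (L * b.1 - L) (L * b.1 + 2 * L) ×ˢ
    Finset.Ico (L * b.2 - L) (L * b.2 + 2 * L) with hS
  set col : ℤ → Finset (ℤ × ℤ) := fun i => (Finset.Ico (0 : ℤ) L).image fun j => site L b i j
    with hcol
  set row : ℤ → Finset (ℤ × ℤ) := fun j => (Finset.Ico (0 : ℤ) L).image fun i => site L b i j
    with hrow
  have hcardS : (S.card : ℝ) = 9 * L ^ 2 := by
    have : S.card = (3 * L) * (3 * L) := by
      rw [hS, Finset.card_product, Int.card_Ico, Int.card_Ico]; congr 1 <;> omega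
    rw [this]; push_cast; ring
  have hcardcol : ∀ i, (col i).card = L := fun i => by
    rw [hcol, Finset.card_image_of_injective _ (fun a b h => by simpa [site] using h)]; simp
  have hcardrow : ∀ j, (row j).card = L := fun j => by
    rw [hrow, Finset.card_image_of_injective _ (fun a b h => by simpa [site] using h)]; simp
  have hsub : {ω : Config | ¬ BoxGood L ω b} ⊆ {ω | ∃ x ∈ S, ω x = 2} ∪
      ((⋃ i ∈ Finset.Ico (0 : ℤ) L, {ω | ∀ x ∈ col i, ω x ≠ 1}) ∪
       (⋃ j ∈ Finset.Ico (0 : ℤ) L, {ω | ∀ x ∈ row j, ω x ≠ 1})) := by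
    intro ω hω
    by_contra hcon
    simp only [Set.mem_union, Set.mem_iUnion, not_or, not_exists, hS, hcol, hrow] at hcon
    obtain ⟨h1, h2, h3⟩ := hcon
    refine hω ⟨fun x k1 k2 k3 k4 hx => h1 ⟨x, ?_, hx⟩, fun i k1 k2 => ?_, fun j k1 k2 => ?_⟩
    · simp only [Finset.mem_product, Finset.mem_Ico]; omega
    · by_contra hno
      refine h2 i (Finset.mem_Ico.2 ⟨k1, k2⟩) fun x hx hx1 => ?_
      obtain ⟨j, hj, rfl⟩ := Finset.mem_image.1 hx
      exact hno ⟨j, (Finset.mem_Ico.1 hj).1, (Finset.mem_Ico.1 hj).2, hx1⟩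
    · by_contra hno
      refine h3 j (Finset.mem_Ico.2 ⟨k1, k2⟩) fun x hx hx1 => ?_
      obtain ⟨i, hi, rfl⟩ := Finset.mem_image.1 hx
      exact hno ⟨i, (Finset.mem_Ico.1 hi).1, (Finset.mem_Ico.1 hi).2, hx1⟩
  refine (measureReal_mono hsub).trans ((measureReal_union_le _ _).trans ?_)
  have e1 := prob_exists_eq_two_le (p := p) hq S
  rw [hcardS] at e1
  have e2 : (initialLaw p q).real
      (⋃ i ∈ Finset.Ico (0 : ℤ) L, {ω | ∀ x ∈ col i, ω x ≠ 1}) ≤ L * (1 - p) ^ L := by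
    refine (measureReal_biUnion_finset_le _ _).trans ?_
    simp only [prob_forall_ne_one hp, hcardcol]
    simp
  have e3 : (initialLaw p q).real
      (⋃ j ∈ Finset.Ico (0 : ℤ) L, {ω | ∀ x ∈ row j, ω x ≠ 1}) ≤ L * (1 - p) ^ L := by
    refine (measureReal_biUnion_finset_le _ _).trans ?_
    simp only [prob_forall_ne_one hp, hcardrow]
    simp
  have e4 := measureReal_union_le (μ := initialLaw p q)
    (⋃ i ∈ Finset.Ico (0 : ℤ) L, {ω | ∀ x ∈ col i, ω x ≠ 1})
    (⋃ j ∈ Finset.Ico (0 : ℤ) L, {ω | ∀ x ∈ row j, ω x ≠ 1})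
  linarith

/-- Bad subcells far from each other are independent, so that the probability of a bad cell is
squared, up to a constant, when the level increases by one. -/
lemma prob_not_good_le {L : ℕ} {ε : ℝ}
    (hε : ∀ b, (initialLaw p q).real {ω | ¬ BoxGood L ω b} ≤ ε) :
    ∀ (n : ℕ) (c : ℤ × ℤ), (initialLaw p q).real {ω | ¬ Good (BoxGood L ω) n c} ≤
      (14641 * ε) ^ 2 ^ n / 14641
  | 0, c => by simpa [Good] using hε c
  | n + 1, c => by
    have ih := prob_not_good_le hε n
    obtain ⟨Q, hQ, hQc⟩ : ∃ Q : Finset ((ℤ × ℤ) × (ℤ × ℤ)),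
        (∀ i j i' j' : ℤ, ((i, j), (i', j')) ∈ Q ↔ (((0 ≤ i ∧ i < 11) ∧ 0 ≤ j ∧ j < 11) ∧
          (0 ≤ i' ∧ i' < 11) ∧ 0 ≤ j' ∧ j' < 11) ∧ ¬ (|i - i'| ≤ 2 ∧ |j - j'| ≤ 2)) ∧
        (Q.card : ℝ) ≤ 14641 := by
      set I := Finset.Ico (0 : ℤ) 11 with hI
      refine ⟨((I ×ˢ I) ×ˢ (I ×ˢ I)).filter fun r =>
        ¬ (|r.1.1 - r.2.1| ≤ 2 ∧ |r.1.2 - r.2.2| ≤ 2), fun i j i' j' => ?_, ?_⟩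
      · simp only [hI, Finset.mem_filter, Finset.mem_product, Finset.mem_Ico]
      · have h2 : ((I ×ˢ I) ×ˢ (I ×ˢ I)).card = 11 ^ 4 := by simp [hI]
        calc _ ≤ (((I ×ˢ I) ×ˢ (I ×ˢ I)).card : ℝ) := Nat.cast_le.2 (Finset.card_filter_le _ _)
          _ = 14641 := by rw [h2]; norm_num
    set bad : ℤ × ℤ → Set Config := fun c => {ω | ¬ Good (BoxGood L ω) n c} with hbad
    have hsub : {ω | ¬ Good (BoxGood L ω) (n + 1) c} ⊆
        ⋃ r ∈ Q, bad (sub c r.1.1 r.1.2) ∩ bad (sub c r.2.1 r.2.2) := by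
      intro ω hω
      by_contra hcon
      simp only [Set.mem_iUnion, not_exists] at hcon
      refine hω fun i j i' j' h1 h2 h3 h4 h5 h6 h7 h8 hb hb' => ?_
      by_contra hd
      exact hcon ((i, j), (i', j')) ((hQ _ _ _ _).2
        ⟨⟨⟨⟨h1, h2⟩, h3, h4⟩, ⟨h5, h6⟩, h7, h8⟩, hd⟩) ⟨hb, hb'⟩
    have hdep : ∀ c, DependsOn (· ∈ bad c) (cellSites L n c : Set (ℤ × ℤ)) := fun c =>
      dependsOn_compl (dependsOn_good L n c)
    refine (measureReal_mono hsub (measure_ne_top _ _)).trans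
      ((measureReal_biUnion_finset_le _ _).trans ?_)
    have hterm : ∀ r ∈ Q, (initialLaw p q).real (bad (sub c r.1.1 r.1.2) ∩ bad (sub c r.2.1 r.2.2))
        ≤ ((14641 * ε) ^ 2 ^ n / 14641) ^ 2 := by
      intro r hr
      have hr2 := ((hQ _ _ _ _).1 hr).2
      rw [prob_inter (hdep _) (hdep _) (disjoint_cellSites ?_), sq]
      · exact mul_le_mul (ih _) (ih _) measureReal_nonneg (measureReal_nonneg.trans (ih c))
      · simp only [sub]
        rwa [show 11 * c.1 + r.1.1 - (11 * c.1 + r.2.1) = r.1.1 - r.2.1 by ring,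
          show 11 * c.2 + r.1.2 - (11 * c.2 + r.2.2) = r.1.2 - r.2.2 by ring]
    refine (Finset.sum_le_card_nsmul _ _ _ hterm).trans ?_
    rw [nsmul_eq_mul]
    calc (Q.card : ℝ) * ((14641 * ε) ^ 2 ^ n / 14641) ^ 2
        ≤ 14641 * ((14641 * ε) ^ 2 ^ n / 14641) ^ 2 := by
          gcongr
      _ = _ := by rw [pow_succ 2 n, pow_mul]; ring

lemma pow_two_pow_le {η : ℝ} (h0 : 0 ≤ η) (h1 : η ≤ 1 / 2) (n : ℕ) :
    η ^ 2 ^ n ≤ η * (1 / 2) ^ n := by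
  have h2 : n + 1 ≤ 2 ^ n := Nat.lt_two_pow_self
  calc η ^ 2 ^ n ≤ η ^ (n + 1) := pow_le_pow_of_le_one h0 (by linarith) h2
    _ = η * η ^ n := by ring
    _ ≤ η * (1 / 2) ^ n := by gcongr

/-- The factor `3 - 2 (1 / 2) ^ n` is what sums the doubly exponentially decaying probabilities of bad
cells along the chain, and is bounded in `n`. -/
lemma prob_not_chain_le {L : ℕ} {ε : ℝ}
    (hε : ∀ b, (initialLaw p q).real {ω | ¬ BoxGood L ω b} ≤ ε) (h1 : 14641 * ε ≤ 1 / 2) :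
    ∀ (n : ℕ) (c : ℤ × ℤ), (initialLaw p q).real {ω | ¬ Chain (BoxGood L ω) n c} ≤
      14641 * ε * (3 - 2 * (1 / 2) ^ n)
  | 0, c => by
    have h0 : 0 ≤ ε := measureReal_nonneg.trans (hε c)
    have := hε c
    simp only [Chain, pow_zero]
    linarith
  | n + 1, c => by
    have h0 : 0 ≤ ε := measureReal_nonneg.trans (hε c)
    set I := Finset.Ico (0 : ℤ) 11 with hI
    have hsub : {ω | ¬ Chain (BoxGood L ω) (n + 1) c} ⊆
        (⋃ r ∈ I ×ˢ I, {ω | ¬ Good (BoxGood L ω) n (sub c r.1 r.2)}) ∪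
          {ω | ¬ Chain (BoxGood L ω) n (sub c 0 0)} := by
      intro ω hω
      by_contra hcon
      simp only [Set.mem_union, Set.mem_iUnion, not_or, not_exists] at hcon
      refine hω ⟨fun i j h1 h2 h3 h4 => ?_, not_not.1 hcon.2⟩
      refine not_not.1 (hcon.1 (i, j) ?_)
      simp only [hI, Finset.mem_product, Finset.mem_Ico]
      exact ⟨⟨h1, h2⟩, h3, h4⟩
    refine (measureReal_mono hsub).trans ((measureReal_union_le _ _).trans ?_)
    have e1 := prob_not_chain_le hε h1 n (sub c 0 0)
    have e2 : (initialLaw p q).real (⋃ r ∈ I ×ˢ I, {ω | ¬ Good (BoxGood L ω) n (sub c r.1 r.2)}) ≤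
        121 * ((14641 * ε) ^ 2 ^ n / 14641) := by
      refine (measureReal_biUnion_finset_le _ _).trans ?_
      refine (Finset.sum_le_card_nsmul _ _ _ fun r _ => prob_not_good_le hε n _).trans ?_
      simp [hI]
    have e3 := pow_two_pow_le (η := 14641 * ε) (by positivity) h1 n
    have e4 : 0 ≤ 14641 * ε * (1 / 2) ^ n := by positivity
    rw [pow_succ]
    linarith

/-! ### Nuclei -/

/-- The vertices of the box `b` whose relative coordinates have maximum `j`. -/
def hookSites (L : ℕ) (b : ℤ × ℤ) (j : ℕ) : Finset (ℤ × ℤ) :=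
  (Finset.range (j + 1)).image (fun i : ℕ => site L b i j) ∪
    (Finset.range (j + 1)).image fun i : ℕ => site L b j i

/-- The vertices of the box `b` whose relative coordinates are both less than `k`. -/
def squareSites (L : ℕ) (b : ℤ × ℤ) (k : ℕ) : Finset (ℤ × ℤ) :=
  (Finset.range k).biUnion (hookSites L b)

lemma mem_hookSites {L : ℕ} {b x : ℤ × ℤ} {j : ℕ} : x ∈ hookSites L b j ↔
    ∃ i : ℤ, 0 ≤ i ∧ i ≤ j ∧ (x = site L b i j ∨ x = site L b j i) := by
  simp only [hookSites, Finset.mem_union, Finset.mem_image, Finset.mem_range]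
  constructor
  · rintro (⟨i, hi, rfl⟩ | ⟨i, hi, rfl⟩)
    · exact ⟨i, by omega, by omega, Or.inl rfl⟩
    · exact ⟨i, by omega, by omega, Or.inr rfl⟩
  · rintro ⟨i, hi, hij, rfl | rfl⟩
    · exact Or.inl ⟨i.toNat, by omega, by rw [Int.toNat_of_nonneg hi]⟩
    · exact Or.inr ⟨i.toNat, by omega, by rw [Int.toNat_of_nonneg hi]⟩

lemma card_hookSites_le (L : ℕ) (b : ℤ × ℤ) (j : ℕ) : (hookSites L b j).card ≤ 2 * (j + 1) := by
  refine (Finset.card_union_le _ _).trans ?_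
  have h1 := Finset.card_image_le (s := Finset.range (j + 1)) (f := fun i : ℕ => site L b i j)
  have h2 := Finset.card_image_le (s := Finset.range (j + 1)) (f := fun i : ℕ => site L b j i)
  rw [Finset.card_range] at h1 h2
  omega

lemma disjoint_hookSites {L : ℕ} {b : ℤ × ℤ} {j k : ℕ} (hjk : j ≠ k) :
    Disjoint (hookSites L b j) (hookSites L b k) := by
  rw [Finset.disjoint_left]
  intro x hx hx'
  obtain ⟨i, hi, hij, h⟩ := mem_hookSites.1 hx
  obtain ⟨i', hi', hij', h'⟩ := mem_hookSites.1 hx'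
  simp only [site, Prod.ext_iff] at h h'
  omega

lemma dependsOn_hook (L : ℕ) (b : ℤ × ℤ) (j : ℕ) :
    DependsOn (· ∈ {ω : Config | Hook L ω b j}) (hookSites L b j : Set (ℤ × ℤ)) := by
  refine dependsOn_of_imp fun ω ω' h hω => ?_
  have h1 : ∀ i : ℤ, 0 ≤ i → i ≤ j → ω (site L b i j) = ω' (site L b i j) := fun i k1 k2 =>
    h _ (mem_hookSites.2 ⟨i, k1, k2, Or.inl rfl⟩)
  have h2 : ∀ i : ℤ, 0 ≤ i → i ≤ j → ω (site L b j i) = ω' (site L b j i) := fun i k1 k2 =>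
    h _ (mem_hookSites.2 ⟨i, k1, k2, Or.inr rfl⟩)
  refine ⟨fun i k1 k2 => ?_, ?_⟩
  · rw [← h1 i k1 k2, ← h2 i k1 k2]; exact hω.1 i k1 k2
  · rcases hω.2 with h3 | ⟨⟨i, k1, k2, k3⟩, i', k1', k2', k3'⟩
    · exact Or.inl (by rw [← h1 j (by omega) le_rfl]; exact h3)
    · exact Or.inr ⟨⟨i, k1, k2, by rw [← h1 i k1 k2.le]; exact k3⟩,
        i', k1', k2', by rw [← h2 i' k1' k2'.le]; exact k3'⟩

/-- A short hook satisfies the hook event if its corner is a `1`. -/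
lemma le_prob_hook (hp : 0 ≤ p) (hq : 0 ≤ q) {L : ℕ} (hLq : 2 * L * q ≤ 1 / 4) (b : ℤ × ℤ) {j : ℕ}
    (hj : j < L) : p / 2 ≤ (initialLaw p q).real {ω | Hook L ω b j} := by
  set x := site L b j j with hx
  set S := (hookSites L b j).erase x with hS
  have hdep1 : DependsOn (· ∈ {ω : Config | ω x = 1}) (({x} : Finset (ℤ × ℤ)) : Set (ℤ × ℤ)) :=
    dependsOn_of_imp fun ω ω' h hω => by
      rw [Set.mem_ofPred_eq, ← h x (by simp)]; exact hω
  have hdep2' : DependsOn (· ∈ {ω : Config | ∃ y ∈ S, ω y = 2}) (S : Set (ℤ × ℤ)) :=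
    dependsOn_of_imp fun ω ω' h ⟨y, hy, hω⟩ => ⟨y, hy, by rw [← h y hy]; exact hω⟩
  have hdep2 := dependsOn_compl hdep2'
  have hsub : {ω : Config | ω x = 1} ∩ {ω : Config | ∃ y ∈ S, ω y = 2}ᶜ ⊆ {ω | Hook L ω b j} := by
    rintro ω ⟨h1, h2⟩
    have hne : ∀ y ∈ hookSites L b j, ω y ≠ 2 := by
      intro y hy hy2
      by_cases hyx : y = x
      · rw [hyx, show ω x = 1 from h1] at hy2; exact absurd hy2 (by decide)
      · exact h2 ⟨y, Finset.mem_erase.2 ⟨hyx, hy⟩, hy2⟩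
    exact ⟨fun i k1 k2 => ⟨hne _ (mem_hookSites.2 ⟨i, k1, k2, Or.inl rfl⟩),
      hne _ (mem_hookSites.2 ⟨i, k1, k2, Or.inr rfl⟩)⟩, Or.inl h1⟩
  refine le_trans ?_ (measureReal_mono hsub)
  rw [prob_inter hdep1 hdep2 (Finset.disjoint_singleton_left.2 (Finset.notMem_erase x _)),
    prob_eq_one hp, measureReal_compl (measurableSet_of_dependsOn hdep2'), probReal_univ]
  have h2 := prob_exists_eq_two_le (p := p) hq S
  have hc : (S.card : ℝ) ≤ 2 * L := by
    have h3 := card_hookSites_le L b j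
    have h4 := Finset.card_le_card (Finset.erase_subset x (hookSites L b j))
    have : S.card ≤ 2 * L := by rw [hS]; omega
    exact_mod_cast this
  have h5 : (S.card : ℝ) * q ≤ 2 * L * q := by gcongr
  nlinarith

/-- A long hook typically has a `1` in both arms. -/
lemma half_le_prob_hook (hp : 0 ≤ p) (hp1 : p ≤ 1) (hq : 0 ≤ q) {L m : ℕ} (hLq : 2 * L * q ≤ 1 / 4)
    (hm : (1 - p) ^ m ≤ 1 / 8) (b : ℤ × ℤ) {j : ℕ} (hj : j < L) (hmj : m ≤ j) :
    1 / 2 ≤ (initialLaw p q).real {ω | Hook L ω b j} := by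
  set R : Finset (ℤ × ℤ) := (Finset.range j).image fun i : ℕ => site L b i j with hR
  set C : Finset (ℤ × ℤ) := (Finset.range j).image fun i : ℕ => site L b j i with hC
  have hRc : R.card = j := by
    rw [hR, Finset.card_image_of_injective _ (fun a b h => by simpa [site] using h)]; simp
  have hCc : C.card = j := by
    rw [hC, Finset.card_image_of_injective _ (fun a b h => by simpa [site] using h)]; simp
  have hsub : {ω | Hook L ω b j}ᶜ ⊆ {ω | ∃ y ∈ hookSites L b j, ω y = 2} ∪
      ({ω | ∀ y ∈ R, ω y ≠ 1} ∪ {ω | ∀ y ∈ C, ω y ≠ 1}) := by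
    intro ω hω
    by_contra hcon
    simp only [Set.mem_union, not_or, Set.mem_ofPred_eq, not_exists, not_and, not_forall,
      not_not] at hcon
    obtain ⟨h1, ⟨y, hy, hy1⟩, z, hz, hz1⟩ := hcon
    refine hω ⟨fun i k1 k2 => ⟨h1 _ (mem_hookSites.2 ⟨i, k1, k2, Or.inl rfl⟩),
      h1 _ (mem_hookSites.2 ⟨i, k1, k2, Or.inr rfl⟩)⟩, Or.inr ⟨?_, ?_⟩⟩
    · obtain ⟨i, hi, rfl⟩ := Finset.mem_image.1 hy
      exact ⟨i, by omega, by have := Finset.mem_range.1 hi; omega, hy1⟩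
    · obtain ⟨i, hi, rfl⟩ := Finset.mem_image.1 hz
      exact ⟨i, by omega, by have := Finset.mem_range.1 hi; omega, hz1⟩
  have h1 := (measureReal_mono (μ := initialLaw p q) hsub).trans (measureReal_union_le _ _)
  have h2 := measureReal_union_le (μ := initialLaw p q) {ω | ∀ y ∈ R, ω y ≠ 1}
    {ω | ∀ y ∈ C, ω y ≠ 1}
  rw [prob_forall_ne_one hp, prob_forall_ne_one hp, hRc, hCc] at h2
  have h3 := prob_exists_eq_two_le (p := p) hq (hookSites L b j)
  have hc : ((hookSites L b j).card : ℝ) ≤ 2 * L := by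
    have h3 := card_hookSites_le L b j
    have : (hookSites L b j).card ≤ 2 * L := by omega
    exact_mod_cast this
  have h5 : ((hookSites L b j).card : ℝ) * q ≤ 2 * L * q := by gcongr
  have h6 : (1 - p) ^ j ≤ (1 - p) ^ m := pow_le_pow_of_le_one (by linarith) (by linarith) hmj
  rw [measureReal_compl (measurableSet_of_dependsOn (dependsOn_hook L b j)), probReal_univ] at h1
  linarith

lemma dependsOn_nucleus (L : ℕ) (b : ℤ × ℤ) :
    DependsOn (· ∈ {ω : Config | Nucleus L ω b}) (squareSites L b L : Set (ℤ × ℤ)) := by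
  refine dependsOn_of_imp fun ω ω' h hω j hj hjL => ?_
  lift j to ℕ using hj
  refine (eq_iff_iff.1 (dependsOn_hook L b j fun x hx => h x ?_)).1 (hω j (by omega) hjL)
  exact Finset.mem_biUnion.2 ⟨j, Finset.mem_range.2 (by omega), hx⟩

/-- Hooks are disjoint, so their events are independent: the `m` shortest ones have probability at
least `p / 2`, the others at least `1 / 2`. -/
lemma le_prob_nucleus (hp : 0 ≤ p) (hp1 : p ≤ 1) (hq : 0 ≤ q) {L m : ℕ}
    (hLq : 2 * L * q ≤ 1 / 4) (hm : (1 - p) ^ m ≤ 1 / 8) (b : ℤ × ℤ) :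
    (p / 2) ^ m * (1 / 2) ^ L ≤ (initialLaw p q).real {ω | Nucleus L ω b} := by
  have main : ∀ k ≤ L, (p / 2) ^ min k m * (1 / 2) ^ k ≤
      (initialLaw p q).real {ω | ∀ j < k, Hook L ω b (j : ℕ)} ∧
      DependsOn (· ∈ {ω : Config | ∀ j < k, Hook L ω b (j : ℕ)})
        (squareSites L b k : Set (ℤ × ℤ)) := by
    intro k
    induction k with
    | zero => intro _; exact ⟨by simp, dependsOn_of_imp fun _ _ _ _ => by simp⟩
    | succ k ih =>
      intro hk
      obtain ⟨ih1, ih2⟩ := ih (by omega)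
      have heq : {ω : Config | ∀ j < k + 1, Hook L ω b (j : ℕ)} =
          {ω | ∀ j < k, Hook L ω b (j : ℕ)} ∩ {ω | Hook L ω b (k : ℕ)} := by
        ext ω
        simp only [Set.mem_inter_iff, Set.mem_ofPred_eq]
        refine ⟨fun h => ⟨fun j hj => h j (by omega), h k (by omega)⟩, fun h j hj => ?_⟩
        rcases (show j < k ∨ j = k by omega) with h' | rfl
        · exact h.1 j h'
        · exact h.2
      constructor
      · rw [heq, prob_inter ih2 (dependsOn_hook L b k)]
        · rcases lt_or_ge k m with hkm | hkm
          · have hh := le_prob_hook (p := p) hp hq hLq b (show k < L by omega)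
            rw [min_eq_left hkm.le] at ih1
            rw [min_eq_left (by omega), pow_succ, pow_succ]
            calc (p / 2) ^ k * (p / 2) * ((1 / 2) ^ k * (1 / 2))
                = ((p / 2) ^ k * (1 / 2) ^ k) * ((p / 2) * (1 / 2)) := by ring
              _ ≤ _ := mul_le_mul ih1 (by linarith) (by positivity) measureReal_nonneg
          · have hh := half_le_prob_hook hp hp1 hq hLq hm b (show k < L by omega) hkm
            rw [min_eq_right hkm] at ih1
            rw [min_eq_right (by omega), pow_succ, ← mul_assoc]
            exact mul_le_mul ih1 hh (by positivity) measureReal_nonneg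
        · rw [squareSites, Finset.disjoint_biUnion_left]
          intro j hj
          exact disjoint_hookSites (by have := Finset.mem_range.1 hj; omega)
      · rw [heq]
        have := dependsOn_inter ih2 (dependsOn_hook L b k)
        refine this.mono ?_
        intro x hx
        rcases hx with hx | hx
        · obtain ⟨j, hj, hx⟩ := Finset.mem_biUnion.1 hx
          exact Finset.mem_biUnion.2 ⟨j, Finset.mem_range.2
            (by have := Finset.mem_range.1 hj; omega), hx⟩
        · exact Finset.mem_biUnion.2 ⟨k, Finset.mem_range.2 (by omega), hx⟩
  have hset : {ω : Config | ∀ j < L, Hook L ω b (j : ℕ)} ⊆ {ω | Nucleus L ω b} := by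
    intro ω hω j hj hjL
    lift j to ℕ using hj
    exact hω j (by omega)
  refine le_trans ?_ ((main L le_rfl).1.trans (measureReal_mono hset))
  gcongr ?_ * _
  exact pow_le_pow_of_le_one (by positivity) (by linarith) (min_le_right _ _)

/-- The configuration `ω` with all vertices of the box `b` set to `1`. -/
noncomputable def overwrite (L : ℕ) (b : ℤ × ℤ) (ω : Config) : Config :=
  open Classical in fun x => if InBox L b x then 1 else ω x

lemma overwrite_of_inBox {L : ℕ} {b x : ℤ × ℤ} {ω : Config} (h : InBox L b x) :
    overwrite L b ω x = 1 := if_pos h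

lemma overwrite_of_not_inBox {L : ℕ} {b x : ℤ × ℤ} {ω : Config} (h : ¬ InBox L b x) :
    overwrite L b ω x = ω x := if_neg h

lemma BoxGood.overwrite {L : ℕ} {b b' : ℤ × ℤ} {ω : Config} (hb : BoxGood L ω b') :
    BoxGood L (overwrite L b ω) b' := by
  have h1 : ∀ x, ω x = 1 → TwoStage.overwrite L b ω x = 1 := by
    intro x hx
    by_cases h : InBox L b x
    · exact overwrite_of_inBox h
    · rw [overwrite_of_not_inBox h, hx]
  refine ⟨fun x k1 k2 k3 k4 => ?_, fun i k1 k2 => ?_, fun j k1 k2 => ?_⟩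
  · by_cases h : InBox L b x
    · rw [overwrite_of_inBox h]; decide
    · rw [overwrite_of_not_inBox h]; exact hb.1 x k1 k2 k3 k4
  · obtain ⟨j, k3, k4, k5⟩ := hb.2.1 i k1 k2
    exact ⟨j, k3, k4, h1 _ k5⟩
  · obtain ⟨i, k3, k4, k5⟩ := hb.2.2 j k1 k2
    exact ⟨i, k3, k4, h1 _ k5⟩

lemma InBox.eq {L : ℕ} {b b' x : ℤ × ℤ} (h : InBox L b x) (h' : InBox L b' x) : b = b' := by
  have key : ∀ a a' y : ℤ, L * a ≤ y ∧ y < L * a + L → L * a' ≤ y ∧ y < L * a' + L → a ≤ a' := by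
    rintro a a' y ⟨h1, h2⟩ ⟨h3, h4⟩
    by_contra hlt
    push Not at hlt
    have hL : (0 : ℤ) < L := by omega
    nlinarith
  exact Prod.ext (le_antisymm (key _ _ _ h.1 h'.1) (key _ _ _ h'.1 h.1))
    (le_antisymm (key _ _ _ h.2 h'.2) (key _ _ _ h'.2 h.2))

lemma Nucleus.ne_two {L : ℕ} {ω : Config} {b x : ℤ × ℤ} (hN : Nucleus L ω b)
    (hx : InBox L b x) : ω x ≠ 2 := by
  obtain ⟨⟨h1, h2⟩, h3, h4⟩ := hx
  have hx : x = site L b (x.1 - L * b.1) (x.2 - L * b.2) := by simp [site]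
  rw [hx]
  rcases le_total (x.1 - L * b.1) (x.2 - L * b.2) with h | h
  · exact ((hN (x.2 - L * b.2) (by omega) (by omega)).1 _ (by omega) h).1
  · exact ((hN (x.1 - L * b.1) (by omega) (by omega)).1 _ (by omega) h).2

/-- If `b` is a nucleus, then overwriting `b` by `1`s makes no box good that is not good already. -/
lemma Nucleus.boxGood_of_overwrite {L : ℕ} {ω : Config} {b b' : ℤ × ℤ} (hN : Nucleus L ω b)
    (hb : BoxGood L (overwrite L b ω) b') : BoxGood L ω b' := by
  have hin : ∀ i j : ℤ, 0 ≤ i → i < L → 0 ≤ j → j < L → InBox L b' (site L b' i j) := by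
    intro i j h1 h2 h3 h4; simp only [InBox, site]; omega
  refine ⟨fun x k1 k2 k3 k4 => ?_, fun i k1 k2 => ?_, fun j k1 k2 => ?_⟩
  · by_cases h : InBox L b x
    · exact hN.ne_two h
    · rw [← overwrite_of_not_inBox (ω := ω) h]; exact hb.1 x k1 k2 k3 k4
  · obtain ⟨j, k3, k4, k5⟩ := hb.2.1 i k1 k2
    by_cases h : InBox L b (site L b' i j)
    · obtain rfl := h.eq (hin i j k1 k2 k3 k4)
      rcases (hN i k1 k2).2 with h | ⟨-, l, l1, l2, l3⟩
      · exact ⟨i, k1, k2, h⟩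
      · exact ⟨l, l1, by omega, l3⟩
    · exact ⟨j, k3, k4, by rw [← overwrite_of_not_inBox (ω := ω) h]; exact k5⟩
  · obtain ⟨i, k3, k4, k5⟩ := hb.2.2 j k1 k2
    by_cases h : InBox L b (site L b' i j)
    · obtain rfl := h.eq (hin i j k3 k4 k1 k2)
      rcases (hN j k1 k2).2 with h | ⟨⟨l, l1, l2, l3⟩, -⟩
      · exact ⟨j, k1, k2, h⟩
      · exact ⟨l, l1, by omega, l3⟩
    · exact ⟨i, k3, k4, by rw [← overwrite_of_not_inBox (ω := ω) h]; exact k5⟩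

/-- The event that the lower left box of the cell `c` of level `n` is a nucleus, and that the chain
of `c` is good once this box has been overwritten by `1`s. The two parts are independent. -/
def seedEvent (L n : ℕ) (c : ℤ × ℤ) : Set Config :=
  {ω | Nucleus L ω (corner n c)} ∩
    {ω | Chain (BoxGood L (overwrite L (corner n c) ω)) n c}

lemma chain_of_mem_seedEvent {L n : ℕ} {c : ℤ × ℤ} {ω : Config} (h : ω ∈ seedEvent L n c) :
    Chain (BoxGood L ω) n c :=
  Chain.mono_on (fun _ _ hb => h.1.boxGood_of_overwrite hb) h.2

lemma mem_squareSites {L : ℕ} {b x : ℤ × ℤ} : x ∈ squareSites L b L ↔ InBox L b x := by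
  simp only [squareSites, Finset.mem_biUnion, Finset.mem_range, mem_hookSites, InBox]
  constructor
  · rintro ⟨j, hj, i, hi, hij, rfl | rfl⟩ <;> simp only [site] <;> omega
  · intro h
    rcases le_total (x.1 - L * b.1) (x.2 - L * b.2) with h' | h'
    · refine ⟨(x.2 - L * b.2).toNat, by omega, x.1 - L * b.1, by omega, by omega, Or.inl ?_⟩
      ext <;> simp only [site] <;> omega
    · refine ⟨(x.1 - L * b.1).toNat, by omega, x.2 - L * b.2, by omega, by omega, Or.inr ?_⟩
      ext <;> simp only [site] <;> omega

lemma dependsOn_chain_overwrite (L n : ℕ) (c : ℤ × ℤ) :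
    DependsOn (· ∈ {ω : Config | Chain (BoxGood L (overwrite L (corner n c) ω)) n c})
      ((cellSites L n c \ squareSites L (corner n c) L : Finset (ℤ × ℤ)) : Set (ℤ × ℤ)) := by
  refine dependsOn_of_imp fun ω ω' h hω => ?_
  refine (eq_iff_iff.1 (dependsOn_chain L n c fun x hx => ?_)).1 hω
  by_cases hxb : InBox L (corner n c) x
  · rw [overwrite_of_inBox hxb, overwrite_of_inBox hxb]
  · rw [overwrite_of_not_inBox hxb, overwrite_of_not_inBox hxb]
    exact h x (Finset.mem_sdiff.2 ⟨hx, fun h' => hxb (mem_squareSites.1 h')⟩)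

lemma dependsOn_seedEvent (L n : ℕ) (c : ℤ × ℤ) :
    DependsOn (· ∈ seedEvent L n c) (cellSites L n c : Set (ℤ × ℤ)) := by
  refine (dependsOn_inter (dependsOn_nucleus L (corner n c))
    (dependsOn_chain_overwrite L n c)).mono ?_
  rintro x (hx | hx)
  · have hx := mem_squareSites.1 hx
    obtain ⟨⟨h1, h2⟩, h3, h4⟩ := hx
    simp only [corner] at h1 h2 h3 h4
    have hp : (1 : ℤ) ≤ 11 ^ n := one_le_pow₀ (by norm_num)
    have hL : (L : ℤ) * 1 ≤ L * 11 ^ n := by gcongr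
    simp only [cellSites, Finset.coe_product, Finset.coe_Ico, Set.mem_prod, Set.mem_Ico, mul_add]
    omega
  · exact (Finset.mem_sdiff.1 hx).1

/-- Overwriting only helps the chain, and makes its goodness independent of the nucleus. -/
lemma le_prob_seedEvent {L n : ℕ} {c : ℤ × ℤ} {ρ : ℝ}
    (hN : ρ ≤ (initialLaw p q).real {ω | Nucleus L ω (corner n c)})
    (hc : (initialLaw p q).real {ω | ¬ Chain (BoxGood L ω) n c} ≤ 1 / 2) :
    ρ / 2 ≤ (initialLaw p q).real (seedEvent L n c) := by
  rw [seedEvent, prob_inter (dependsOn_nucleus L _) (dependsOn_chain_overwrite L n c)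
    Finset.disjoint_sdiff]
  have h1 : {ω : Config | Chain (BoxGood L ω) n c} ⊆
      {ω | Chain (BoxGood L (overwrite L (corner n c) ω)) n c} := fun ω hω =>
    Chain.mono_on (fun _ _ hb => hb.overwrite) hω
  have h2 := measureReal_compl (μ := initialLaw p q)
    (measurableSet_of_dependsOn (dependsOn_chain L n c))
  rw [probReal_univ] at h2
  change (initialLaw p q).real {ω | ¬ Chain (BoxGood L ω) n c} = _ at h2
  have h3 := measureReal_mono (μ := initialLaw p q) h1
  calc ρ / 2 = ρ * (1 / 2) := by ring
    _ ≤ _ := mul_le_mul hN (by linarith) (by norm_num) measureReal_nonneg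

/-- The cells `(0, 0), (3, 0), (6, 0), …` are far enough apart for their seed events to be
independent. -/
lemma prob_no_seedEvent_le {L n : ℕ} {ρ : ℝ} (hρ1 : ρ ≤ 1)
    (hs : ∀ c, ρ ≤ (initialLaw p q).real (seedEvent L n c)) :
    ∀ K : ℕ, (initialLaw p q).real {ω | ∀ k < K, ω ∉ seedEvent L n (3 * (k : ℤ), 0)} ≤
      (1 - ρ) ^ K ∧
      DependsOn (· ∈ {ω : Config | ∀ k < K, ω ∉ seedEvent L n (3 * (k : ℤ), 0)})
        (((Finset.range K).biUnion fun k : ℕ => cellSites L n (3 * (k : ℤ), 0) :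
          Finset (ℤ × ℤ)) : Set (ℤ × ℤ)) := by
  intro K
  induction K with
  | zero => exact ⟨by simp, dependsOn_of_imp fun _ _ _ _ => by simp⟩
  | succ K ih =>
    obtain ⟨ih1, ih2⟩ := ih
    have heq : {ω | ∀ k < K + 1, ω ∉ seedEvent L n (3 * (k : ℤ), 0)} =
        {ω | ∀ k < K, ω ∉ seedEvent L n (3 * (k : ℤ), 0)} ∩ (seedEvent L n (3 * (K : ℤ), 0))ᶜ := by
      ext ω
      refine ⟨fun h => ⟨fun j hj => h j (by omega), h K (by omega)⟩, fun h j hj => ?_⟩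
      rcases (show j < K ∨ j = K by omega) with h' | rfl
      · exact h.1 j h'
      · exact h.2
    have hdep := dependsOn_compl (dependsOn_seedEvent L n (3 * (K : ℤ), 0))
    constructor
    · rw [heq, prob_inter ih2 hdep, pow_succ, measureReal_compl
        (measurableSet_of_dependsOn (dependsOn_seedEvent L n _)), probReal_univ]
      · have := hs (3 * (K : ℤ), 0)
        have h1 : (initialLaw p q).real (seedEvent L n (3 * (K : ℤ), 0)) ≤ 1 := measureReal_le_one
        exact mul_le_mul ih1 (by linarith) (by linarith) (pow_nonneg (by linarith) _)
      · rw [Finset.disjoint_biUnion_left]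
        intro j hj
        have := Finset.mem_range.1 hj
        refine disjoint_cellSites fun h => ?_
        have := h.1
        rw [abs_le] at this
        simp only at this
        omega
    · rw [heq]
      refine (dependsOn_inter ih2 hdep).mono ?_
      rintro x (hx | hx)
      · obtain ⟨j, hj, hx⟩ := Finset.mem_biUnion.1 hx
        exact Finset.mem_biUnion.2 ⟨j, Finset.mem_range.2
          (by have := Finset.mem_range.1 hj; omega), hx⟩
      · exact Finset.mem_biUnion.2 ⟨K, Finset.mem_range.2 (by omega), hx⟩

/-! ### Dense squares of `2`s are unlikely -/

/-- A union bound over the `k`-element subsets of `S`. -/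
lemma prob_le_card_eq_two_le (hq : 0 ≤ q) (S : Finset (ℤ × ℤ)) (k : ℕ) :
    (initialLaw p q).real {ω | k ≤ (S.filter fun x => ω x = 2).card} ≤ (S.card * q) ^ k := by
  have hsub : {ω : Config | k ≤ (S.filter fun x => ω x = 2).card} ⊆
      ⋃ A ∈ S.powersetCard k, {ω | ∀ x ∈ A, ω x = 2} := by
    intro ω hω
    obtain ⟨A, hA, hAc⟩ := Finset.exists_subset_card_eq (show k ≤ _ from hω)
    simp only [Set.mem_iUnion]
    refine ⟨A, Finset.mem_powersetCard.2 ⟨hA.trans (Finset.filter_subset _ _), hAc⟩, ?_⟩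
    exact fun x hx => (Finset.mem_filter.1 (hA hx)).2
  refine (measureReal_mono hsub (measure_ne_top _ _)).trans
    ((measureReal_biUnion_finset_le _ _).trans ?_)
  have hterm : ∀ A ∈ S.powersetCard k, (initialLaw p q).real {ω | ∀ x ∈ A, ω x = 2} ≤ q ^ k :=
    fun A hA => by rw [prob_forall_eq_two hq, (Finset.mem_powersetCard.1 hA).2]
  refine (Finset.sum_le_card_nsmul _ _ _ hterm).trans ?_
  rw [nsmul_eq_mul, Finset.card_powersetCard, mul_pow]
  gcongr
  exact_mod_cast Nat.choose_le_pow _ _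

lemma card_Icc_add (a : ℤ × ℤ) (k : ℕ) :
    (Finset.Icc a (a + ((k : ℤ), (k : ℤ)))).card = (k + 1) ^ 2 := by
  rw [Finset.card_Icc_prod, Int.card_Icc, Int.card_Icc, sq]
  simp only [Prod.fst_add, Prod.snd_add]
  congr 1 <;> omega

lemma prob_not_noDenseSquare_le (hq : 0 ≤ q) (L T : ℕ) :
    (initialLaw p q).real {ω | ¬ NoDenseSquare L T ω} ≤
      (3 * T + 1) ^ 2 * ((2 * L + 1) ^ 2 * q) ^ (L / 2 + 1) := by
  obtain ⟨D, hD, hDc⟩ : ∃ D : Finset (ℤ × ℤ), (∀ a, (-(T : ℤ), -(T : ℤ)) ≤ a →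
      a ≤ (2 * (T : ℤ), 2 * (T : ℤ)) → a ∈ D) ∧ (D.card : ℝ) = (3 * T + 1) ^ 2 := by
    refine ⟨Finset.Icc (-(T : ℤ), -(T : ℤ))
      ((-(T : ℤ), -(T : ℤ)) + (((3 * T : ℕ) : ℤ), ((3 * T : ℕ) : ℤ))), fun a h1 h2 => ?_, ?_⟩
    · refine Finset.mem_Icc.2 ⟨h1, h2.1.trans ?_, h2.2.trans ?_⟩ <;> simp <;> omega
    · rw [card_Icc_add]; push_cast; ring
  have hsub : {ω : Config | ¬ NoDenseSquare L T ω} ⊆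
      ⋃ a ∈ D, {ω | L / 2 + 1 ≤ ((Finset.Icc a (a + (((2 * L : ℕ) : ℤ), ((2 * L : ℕ) : ℤ)))).filter
        fun x => ω x = 2).card} := by
    intro ω hω
    by_contra hcon
    simp only [Set.mem_iUnion, not_exists] at hcon
    refine hω fun a h1 h2 => ?_
    have h3 := hcon a (hD a h1 h2)
    rw [Set.mem_ofPred_eq, not_le] at h3
    push_cast at h3
    omega
  refine (measureReal_mono hsub (measure_ne_top _ _)).trans
    ((measureReal_biUnion_finset_le _ _).trans ?_)
  have hterm : ∀ a ∈ D, (initialLaw p q).real {ω | L / 2 + 1 ≤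
      ((Finset.Icc a (a + (((2 * L : ℕ) : ℤ), ((2 * L : ℕ) : ℤ)))).filter
        fun x => ω x = 2).card} ≤ ((2 * L + 1) ^ 2 * q) ^ (L / 2 + 1) := by
    intro a _
    have h1 := prob_le_card_eq_two_le (p := p) hq
      (Finset.Icc a (a + (((2 * L : ℕ) : ℤ), ((2 * L : ℕ) : ℤ)))) (L / 2 + 1)
    rw [card_Icc_add] at h1
    exact_mod_cast h1
  refine (Finset.sum_le_card_nsmul _ _ _ hterm).trans ?_
  rw [nsmul_eq_mul, hDc]

/-! ### The quantitative estimate -/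

/-- A lower bound in terms of the scales. The error terms come from the chain of the origin, from bad
cells in the row of `3K + 1` cells of level `n`, from the absence of a seed among `K` candidates, and
from dense squares of `2`s. -/
lemma prob_originLeavesZero_ge (v : Variant) {L n K T : ℕ} (hL : 2 ≤ L) {ε ρ : ℝ}
    (hT : (L * (11 ^ n * (3 * K + 1))) ^ 2 ≤ T) (hq : 0 ≤ q)
    (hε : ∀ b, (initialLaw p q).real {ω | ¬ BoxGood L ω b} ≤ ε) (hε' : 14641 * ε ≤ 1 / 6)
    (hN : ∀ b, ρ ≤ (initialLaw p q).real {ω | Nucleus L ω b}) :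
    1 - (3 * (14641 * ε) + (3 * K + 1) * (14641 * ε) ^ 2 ^ n + (1 - ρ / 2) ^ K +
      (3 * T + 1) ^ 2 * ((2 * L + 1) ^ 2 * q) ^ (L / 2 + 1)) ≤
      (initialLaw p q).real (originLeavesZero v) := by
  have h0 : 0 ≤ ε := measureReal_nonneg.trans (hε 0)
  have hch : ∀ c, (initialLaw p q).real {ω | ¬ Chain (BoxGood L ω) n c} ≤ 3 * (14641 * ε) := by
    intro c
    refine (prob_not_chain_le hε (by linarith) n c).trans ?_
    have : 0 ≤ 14641 * ε * (1 / 2) ^ n := by positivity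
    linarith
  set B1 : Set Config := {ω | ¬ Chain (BoxGood L ω) n (0, 0)} with hB1
  set B2 : Set Config := ⋃ i ∈ Finset.range (3 * K + 1),
    {ω | ¬ Good (BoxGood L ω) n ((i : ℕ), 0)} with hB2
  set B3 : Set Config := {ω | ∀ k < K, ω ∉ seedEvent L n (3 * (k : ℤ), 0)} with hB3
  set B4 : Set Config := {ω | ¬ NoDenseSquare L T ω} with hB4
  have hcover : (Set.univ : Set Config) ⊆ originLeavesZero v ∪ (B1 ∪ (B2 ∪ (B3 ∪ B4))) := by
    intro ω _
    by_contra hcon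
    simp only [Set.mem_union, not_or] at hcon
    obtain ⟨hno, h1, h2, h3, h4⟩ := hcon
    simp only [hB3, Set.mem_ofPred_eq, not_forall, not_not] at h3
    obtain ⟨k, hk, hseed⟩ := h3
    refine hno (mem_originLeavesZero_of_nucleus (M := 3 * K) (m := 3 * k) hL hT (not_not.1 h4)
      (by omega) (by push_cast; omega) (fun i hi hiM => ?_) (not_not.1 h1)
      (chain_of_mem_seedEvent hseed) hseed.1)
    simp only [hB2, Set.mem_iUnion, not_exists] at h2
    have := not_not.1 (h2 i.toNat (Finset.mem_range.2 (by omega)))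
    rwa [Int.toNat_of_nonneg hi] at this
  have hone := measureReal_mono (μ := initialLaw p q) hcover (measure_ne_top _ _)
  rw [probReal_univ] at hone
  have u1 := measureReal_union_le (μ := initialLaw p q) (originLeavesZero v)
    (B1 ∪ (B2 ∪ (B3 ∪ B4)))
  have u2 := measureReal_union_le (μ := initialLaw p q) B1 (B2 ∪ (B3 ∪ B4))
  have u3 := measureReal_union_le (μ := initialLaw p q) B2 (B3 ∪ B4)
  have u4 := measureReal_union_le (μ := initialLaw p q) B3 B4
  have e1 := hch (0, 0)
  have e2 : (initialLaw p q).real B2 ≤ (3 * K + 1) * (14641 * ε) ^ 2 ^ n := by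
    refine (measureReal_biUnion_finset_le _ _).trans ?_
    refine (Finset.sum_le_card_nsmul _ _ _ fun i _ => prob_not_good_le hε n _).trans ?_
    rw [Finset.card_range, nsmul_eq_mul]
    push_cast
    gcongr
    exact div_le_self (by positivity) (by norm_num)
  have hρ1 : ρ ≤ 1 := (hN 0).trans measureReal_le_one
  have e3 := (prob_no_seedEvent_le (p := p) (q := q) (L := L) (n := n) (ρ := ρ / 2) (by linarith)
    (fun c => le_prob_seedEvent (hN _) ((hch c).trans (by linarith))) K).1
  have e4 := prob_not_noDenseSquare_le (p := p) hq L T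
  linarith

end Probability

/-! ### Choice of the scales -/

lemma ten_mul_add_two_le_two_pow {L : ℕ} (hL : 7 ≤ L) : 10 * L + 2 ≤ 2 ^ L := by
  induction L, hL using Nat.le_induction with
  | base => norm_num
  | succ L hL ih => rw [pow_succ]; omega

lemma three_mul_pow_add_one_le {L k : ℕ} (hL : 2 ≤ L) : 3 * 2 ^ (k * L) + 1 ≤ 2 ^ ((k + 1) * L) := by
  have h1 : 1 ≤ 2 ^ (k * L) := Nat.one_le_two_pow
  have h2 : 2 ^ 2 ≤ 2 ^ L := Nat.pow_le_pow_right (by norm_num) hL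
  rw [add_mul, one_mul, pow_add]
  nlinarith

/-- The number of vertices in the region of interest, which bounds the time for filling it, is at
most `2 ^ (30 * L)`. -/
lemma time_le {L : ℕ} (hL : 2 ≤ L) : (L * (11 ^ L * (3 * 2 ^ (9 * L) + 1))) ^ 2 ≤ 2 ^ (30 * L) := by
  have h1 : L ≤ 2 ^ L := Nat.lt_two_pow_self.le
  have h2 : 11 ^ L ≤ 2 ^ (4 * L) := by
    rw [pow_mul]; exact Nat.pow_le_pow_left (by norm_num) L
  have h3 := three_mul_pow_add_one_le (k := 9) hL
  calc (L * (11 ^ L * (3 * 2 ^ (9 * L) + 1))) ^ 2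
      ≤ (2 ^ L * (2 ^ (4 * L) * 2 ^ ((9 + 1) * L))) ^ 2 := by gcongr
    _ = 2 ^ (30 * L) := by
        rw [← pow_add, ← pow_add, ← pow_mul]; congr 1; ring

/-- With level `L`, the doubly exponential decay beats the number of cells in the row. -/
lemma row_term_le {L : ℕ} (hL : 7 ≤ L) {η : ℝ} (h0 : 0 ≤ η) (h1 : η ≤ 1 / 2) :
    (3 * ((2 ^ (9 * L) : ℕ) : ℝ) + 1) * η ^ 2 ^ L ≤ (1 / 2) ^ L := by
  have h2 : (3 * ((2 ^ (9 * L) : ℕ) : ℝ) + 1) ≤ 2 ^ (9 * L + 2) := by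
    have h3 : (1 : ℝ) ≤ 2 ^ (9 * L) := one_le_pow₀ (by norm_num)
    push_cast
    rw [pow_add]
    linarith
  calc (3 * ((2 ^ (9 * L) : ℕ) : ℝ) + 1) * η ^ 2 ^ L
      ≤ 2 ^ (9 * L + 2) * (1 / 2) ^ 2 ^ L := by gcongr
    _ ≤ 2 ^ (9 * L + 2) * (1 / 2) ^ (10 * L + 2) := by
        gcongr ?_ * ?_
        exact pow_le_pow_of_le_one (by norm_num) (by norm_num) (ten_mul_add_two_le_two_pow hL)
    _ = (2 * (1 / 2)) ^ (9 * L + 2) * (1 / 2) ^ L := by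
        rw [show 10 * L + 2 = (9 * L + 2) + L by ring, pow_add, mul_pow]; ring
    _ = (1 / 2) ^ L := by norm_num

/-- Here `y` stands for `(2L + 1)² q`: once it is small enough, the density of `2`s beats the number of
squares. -/
lemma dense_term_le {L : ℕ} (hL : 2 ≤ L) {y : ℝ} (h0 : 0 ≤ y) (h1 : y ≤ (1 / 2) ^ 128) :
    (3 * ((2 ^ (30 * L) : ℕ) : ℝ) + 1) ^ 2 * y ^ (L / 2 + 1) ≤ (1 / 2) ^ L := by
  have h2 : (3 * ((2 ^ (30 * L) : ℕ) : ℝ) + 1) ≤ 2 ^ (31 * L) := by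
    exact_mod_cast three_mul_pow_add_one_le (k := 30) hL
  calc (3 * ((2 ^ (30 * L) : ℕ) : ℝ) + 1) ^ 2 * y ^ (L / 2 + 1)
      ≤ (2 ^ (31 * L)) ^ 2 * ((1 / 2) ^ 128) ^ (L / 2 + 1) := by gcongr
    _ = 2 ^ (62 * L) * (1 / 2) ^ (128 * (L / 2 + 1)) := by
        rw [← pow_mul, ← pow_mul]; congr 2; ring
    _ ≤ 2 ^ (62 * L) * (1 / 2) ^ (63 * L) := by
        gcongr ?_ * ?_
        exact pow_le_pow_of_le_one (by norm_num) (by norm_num) (by omega)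
    _ = (2 * (1 / 2)) ^ (62 * L) * (1 / 2) ^ L := by
        rw [show 63 * L = 62 * L + L by ring, pow_add, mul_pow]; ring
    _ = (1 / 2) ^ L := by norm_num

/-- The factor `(p / 2) ^ ⌈3 / p⌉` in the probability of a nucleus, which comes from its diagonal, is
at least `exp (-4 L)`. -/
lemma nucleus_cost_ge {p : ℝ} (hp : 0 < p) (hp2 : p ≤ 1 / 2) {L : ℕ}
    (hL : 2 / p * Real.log (1 / p) ≤ L) : (1 / 64 : ℝ) ^ L ≤ (p / 2) ^ ⌈3 / p⌉₊ := by
  have hlog : Real.log 2 ≤ Real.log (1 / p) :=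
    Real.log_le_log (by norm_num) (by rw [le_div_iff₀ hp]; linarith)
  have hlog0 : 0 < Real.log 2 := Real.log_pos (by norm_num)
  have hm : (⌈3 / p⌉₊ : ℝ) ≤ 4 / p := by
    have h1 := (Nat.ceil_lt_add_one (show 0 ≤ 3 / p by positivity)).le
    have h2 : 1 ≤ 1 / p := by rw [le_div_iff₀ hp]; linarith
    have h3 : 4 / p = 3 / p + 1 / p := by ring
    linarith
  have hlp : Real.log (p / 2) = -(Real.log (1 / p) + Real.log 2) := by
    rw [Real.log_div hp.ne' (by norm_num), one_div, Real.log_inv]; ring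
  have h64 : 4 ≤ Real.log 64 := by
    have h1 : Real.log 64 = 6 * Real.log 2 := by
      rw [show (64 : ℝ) = 2 ^ 6 by norm_num, Real.log_pow]; norm_num
    have := Real.log_two_gt_d9
    linarith
  rw [← Real.log_le_log_iff (by positivity) (by positivity), Real.log_pow, Real.log_pow, hlp,
    one_div 64, Real.log_inv]
  have h1 : (⌈3 / p⌉₊ : ℝ) * (Real.log (1 / p) + Real.log 2) ≤ 4 / p * (2 * Real.log (1 / p)) := by
    apply mul_le_mul hm (by linarith) (by linarith) (by positivity)
  have h2 : 4 / p * (2 * Real.log (1 / p)) = 4 * (2 / p * Real.log (1 / p)) := by ring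
  have h3 : (L : ℝ) * 4 ≤ L * Real.log 64 := by gcongr
  linarith

/-- With `2 ^ (9 * L)` candidates, a seed of probability at least `128 ^ (-L) / 2` appears. -/
lemma seed_term_le {L : ℕ} (hL : 2 ≤ L) {ρ : ℝ} (h : (1 / 128 : ℝ) ^ L ≤ ρ) (h1 : ρ ≤ 1) :
    (1 - ρ / 2) ^ (2 ^ (9 * L)) ≤ (1 / 2) ^ L := by
  have hK : (2 : ℝ) ^ L ≤ 2 ^ (9 * L) * (ρ / 2) := by
    calc (2 : ℝ) ^ L = 2 ^ L * 1 := by ring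
      _ ≤ 2 ^ L * (2 ^ L / 2) := by
        gcongr
        have : (2 : ℝ) ^ 1 ≤ 2 ^ L := pow_le_pow_right₀ (by norm_num) (by omega)
        linarith
      _ = (512 * (1 / 128)) ^ L / 2 := by
        rw [show (512 * (1 / 128) : ℝ) = 2 * 2 by norm_num, mul_pow]; ring
      _ = 2 ^ (9 * L) * ((1 / 128) ^ L / 2) := by
        rw [mul_pow, pow_mul]; norm_num; ring
      _ ≤ 2 ^ (9 * L) * (ρ / 2) := by gcongr
  have h2 : 1 - ρ / 2 ≤ Real.exp (-(ρ / 2)) := by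
    have := Real.add_one_le_exp (-(ρ / 2)); linarith
  calc (1 - ρ / 2) ^ (2 ^ (9 * L)) ≤ Real.exp (-(ρ / 2)) ^ (2 ^ (9 * L)) := by
        gcongr; linarith
    _ = Real.exp (-(2 ^ (9 * L) * (ρ / 2))) := by
        rw [← Real.exp_nat_mul]; push_cast; congr 1; ring
    _ ≤ Real.exp (-2 ^ L) := by gcongr
    _ = (Real.exp (2 ^ L))⁻¹ := Real.exp_neg _
    _ ≤ (2 ^ L)⁻¹ := by
        gcongr
        have := Real.add_one_le_exp ((2 : ℝ) ^ L); linarith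
    _ = (1 / 2) ^ L := by rw [one_div, inv_pow]

lemma one_sub_pow_ceil_le {p : ℝ} (hp : 0 < p) (hp1 : p ≤ 1) : (1 - p) ^ ⌈3 / p⌉₊ ≤ 1 / 8 := by
  have h1 : 1 - p ≤ Real.exp (-p) := by have := Real.add_one_le_exp (-p); linarith
  have h2 : 3 ≤ (⌈3 / p⌉₊ : ℝ) * p := by
    have := Nat.le_ceil (3 / p)
    rwa [div_le_iff₀ hp] at this
  have h3 : (8 : ℝ) ≤ Real.exp 3 := by
    have h4 : Real.exp 3 = Real.exp 1 ^ 3 := by rw [← Real.exp_nat_mul]; norm_num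
    have h5 : (2 : ℝ) ≤ Real.exp 1 := by have := Real.exp_one_gt_d9; linarith
    rw [h4]
    calc (8 : ℝ) = 2 ^ 3 := by norm_num
      _ ≤ _ := by gcongr
  calc (1 - p) ^ ⌈3 / p⌉₊ ≤ Real.exp (-p) ^ ⌈3 / p⌉₊ := by gcongr
    _ = Real.exp (-(⌈3 / p⌉₊ * p)) := by rw [← Real.exp_nat_mul]; congr 1; ring
    _ ≤ Real.exp (-3) := by gcongr
    _ = 1 / Real.exp 3 := by rw [Real.exp_neg, one_div]
    _ ≤ 1 / 8 := by gcongr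

/-- The estimate at a single value of `p`, with all scales expressed through the box side `L`. -/
lemma prob_originLeavesZero_ge_of_scale (v : Variant) {p q : ℝ} (hp : 0 < p) (hp2 : p ≤ 1 / 2)
    (hq : 0 ≤ q) (hpq : p + q ≤ 1) {L : ℕ} (hL : 7 ≤ L) (hLp : 2 / p * Real.log (1 / p) ≤ L)
    (hLq : (2 * L + 1) ^ 2 * q ≤ (1 / 2) ^ 128)
    (hε : 14641 * (9 * L ^ 2 * q + 2 * L * (1 - p) ^ L) ≤ 1 / 6) :
    1 - (3 * (14641 * (9 * L ^ 2 * q + 2 * L * (1 - p) ^ L)) + 3 * (1 / 2) ^ L) ≤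
      (initialLaw p q).real (originLeavesZero v) := by
  have := isProbabilityMeasure_siteLaw hp.le hq hpq
  have hL2 : 2 ≤ L := by omega
  have h2Lq : 2 * L * q ≤ 1 / 4 := by
    have h1 : 2 * (L : ℝ) * q ≤ (2 * L + 1) ^ 2 * q := by
      gcongr
      nlinarith [Nat.cast_nonneg (α := ℝ) L]
    have h2 : (1 / 2 : ℝ) ^ 128 ≤ (1 / 2) ^ 2 :=
      pow_le_pow_of_le_one (by norm_num) (by norm_num) (by norm_num)
    linarith
  set ρ : ℝ := (p / 2) ^ ⌈3 / p⌉₊ * (1 / 2) ^ L with hρ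
  have hN : ∀ b, ρ ≤ (initialLaw p q).real {ω | Nucleus L ω b} := fun b =>
    le_prob_nucleus hp.le (by linarith) hq h2Lq (one_sub_pow_ceil_le hp (by linarith)) b
  have hρ1 : ρ ≤ 1 := (hN 0).trans measureReal_le_one
  have hρ2 : (1 / 128 : ℝ) ^ L ≤ ρ := by
    rw [show (1 / 128 : ℝ) = 1 / 64 * (1 / 2) by norm_num, mul_pow]
    exact mul_le_mul_of_nonneg_right (nucleus_cost_ge hp hp2 hLp) (by positivity)
  have hp0 : (0 : ℝ) ≤ 1 - p := by linarith
  have hmain := prob_originLeavesZero_ge (p := p) (q := q) v (n := L) (K := 2 ^ (9 * L))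
    (T := 2 ^ (30 * L)) hL2 (time_le hL2) hq (prob_not_boxGood_le hp.le hq L) hε hN
  have e1 := row_term_le hL (η := 14641 * (9 * L ^ 2 * q + 2 * L * (1 - p) ^ L)) (by positivity)
    (by linarith)
  have e2 := seed_term_le hL2 hρ2 hρ1
  have e3 := dense_term_le hL2 (y := (2 * L + 1) ^ 2 * q) (by positivity) hLq
  linarith

/-- The side of the boxes: `2 p⁻¹ log p⁻¹`, rounded up. -/
noncomputable def boxSide (p : ℝ) : ℕ := ⌈2 / p * Real.log (1 / p)⌉₊

lemma tendsto_boxSide : Tendsto boxSide (𝓝[>] 0) atTop := by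
  refine tendsto_nat_ceil_atTop.comp ?_
  have h1 : Tendsto (fun p : ℝ => 1 / p) (𝓝[>] 0) atTop := by
    simpa using tendsto_inv_nhdsGT_zero (𝕜 := ℝ)
  have h2 := Real.tendsto_log_atTop.comp h1
  have h3 := (h1.const_mul_atTop (show (0 : ℝ) < 2 by norm_num)).atTop_mul_atTop₀ h2
  refine h3.congr fun p => ?_
  simp only [Function.comp]; ring

/-- For small `p` the side of the boxes has the order `p⁻¹ log p⁻¹`. -/
lemma eventually_boxSide_le : ∀ᶠ p in 𝓝[>] (0 : ℝ),
    1 ≤ 1 / p * Real.log (1 / p) ∧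
      2 * (boxSide p : ℝ) + 1 ≤ 7 * (1 / p * Real.log (1 / p)) := by
  have h : ∀ᶠ p in 𝓝[>] (0 : ℝ), p ∈ Set.Ioo 0 (Real.exp (-1)) :=
    Ioo_mem_nhdsGT (Real.exp_pos _)
  filter_upwards [h] with p ⟨hp, hp1⟩
  have h1 : 1 ≤ Real.log (1 / p) := by
    have := Real.log_lt_log hp hp1
    rw [Real.log_exp] at this
    rw [one_div, Real.log_inv]; linarith
  have h2 : 1 ≤ 1 / p := by
    rw [le_div_iff₀ hp]
    have : Real.exp (-1) ≤ 1 := Real.exp_le_one_iff.2 (by norm_num)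
    linarith
  have h3 : 1 ≤ 1 / p * Real.log (1 / p) := one_le_mul_of_one_le_of_one_le h2 h1
  refine ⟨h3, ?_⟩
  have h4 : (boxSide p : ℝ) < 2 / p * Real.log (1 / p) + 1 :=
    Nat.ceil_lt_add_one (by positivity)
  have h5 : 2 / p * Real.log (1 / p) = 2 * (1 / p * Real.log (1 / p)) := by ring
  linarith

lemma tendsto_boxSide_sq_mul {q : ℝ → ℝ} (hq_pos : ∀ᶠ p in 𝓝[>] (0 : ℝ), 0 < q p)
    (hq_small : q =o[𝓝[>] (0 : ℝ)] fun p : ℝ => p ^ 2 / (Real.log (1 / p)) ^ 2) :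
    Tendsto (fun p => (2 * (boxSide p : ℝ) + 1) ^ 2 * q p) (𝓝[>] 0) (𝓝 0) := by
  have h1 := (hq_small.tendsto_div_nhds_zero).const_mul 49
  rw [mul_zero] at h1
  refine squeeze_zero' ?_ ?_ h1
  · filter_upwards [hq_pos] with p hp
    positivity
  · filter_upwards [hq_pos, eventually_boxSide_le] with p hp ⟨_, h3⟩
    calc (2 * (boxSide p : ℝ) + 1) ^ 2 * q p
        ≤ (7 * (1 / p * Real.log (1 / p))) ^ 2 * q p := by gcongr
      _ = 49 * (q p / (p ^ 2 / Real.log (1 / p) ^ 2)) := by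
          rw [div_div_eq_mul_div]; ring

/-- The expected number of rows and columns of a box without a `1` tends to zero: it is of the order
`L p²`, because `(1 - p) ^ L ≤ exp (-2 log p⁻¹)`. -/
lemma tendsto_empty_line : Tendsto (fun p => 2 * (boxSide p : ℝ) * (1 - p) ^ boxSide p)
    (𝓝[>] 0) (𝓝 0) := by
  have h1 := ((Real.continuous_mul_log.tendsto 0).mono_left
    (nhdsWithin_le_nhds (s := Set.Ioi 0))).const_mul (-7)
  rw [zero_mul, mul_zero] at h1
  have hlt : ∀ᶠ p in 𝓝[>] (0 : ℝ), p ∈ Set.Ioo (0 : ℝ) 1 := Ioo_mem_nhdsGT one_pos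
  refine squeeze_zero' ?_ ?_ h1
  · filter_upwards [hlt] with p ⟨_, hp1⟩
    have : 0 ≤ 1 - p := by linarith
    positivity
  · filter_upwards [hlt, eventually_boxSide_le] with p ⟨hp, hp1⟩ ⟨_, h3⟩
    have h4 : 1 - p ≤ Real.exp (-p) := by have := Real.add_one_le_exp (-p); linarith
    have h5 : 2 * Real.log (1 / p) ≤ boxSide p * p := by
      have := Nat.le_ceil (2 / p * Real.log (1 / p))
      calc 2 * Real.log (1 / p) = 2 / p * Real.log (1 / p) * p := by field_simp
        _ ≤ _ := by gcongr; exact this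
    have h6 : (1 - p) ^ boxSide p ≤ p ^ 2 := by
      calc (1 - p) ^ boxSide p ≤ Real.exp (-p) ^ boxSide p := by gcongr
        _ = Real.exp (-(boxSide p * p)) := by rw [← Real.exp_nat_mul]; congr 1; ring
        _ ≤ Real.exp (-(2 * Real.log (1 / p))) := by gcongr
        _ = p ^ 2 := by
          rw [one_div, Real.log_inv, show -(2 * -Real.log p) = (2 : ℕ) * Real.log p by
            push_cast; ring, Real.exp_nat_mul, Real.exp_log hp]
    have h7 : (0 : ℝ) ≤ 1 - p := by linarith
    calc 2 * (boxSide p : ℝ) * (1 - p) ^ boxSide p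
        ≤ 7 * (1 / p * Real.log (1 / p)) * p ^ 2 := by
          apply mul_le_mul (by linarith) h6 (by positivity)
          have : (0 : ℝ) ≤ boxSide p := Nat.cast_nonneg _
          linarith
      _ = -7 * (p * Real.log p) := by
          rw [one_div, Real.log_inv]; field_simp

end TwoStage

theorem theorem1p1 (v : TwoStage.Variant) (q : ℝ → ℝ)
    (hq_pos : ∀ᶠ p in 𝓝[>] (0 : ℝ), 0 < q p)
    (hq_small : q =o[𝓝[>] (0 : ℝ)] fun p : ℝ => p ^ 2 / (Real.log (1 / p)) ^ 2) :
    Tendsto (fun p : ℝ => TwoStage.initialLaw p (q p) (TwoStage.originLeavesZero v))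
      (𝓝[>] (0 : ℝ)) (𝓝 1) := by
  have hq0 := TwoStage.tendsto_boxSide_sq_mul hq_pos hq_small
  have hline := TwoStage.tendsto_empty_line
  have hside := TwoStage.tendsto_boxSide
  have hsmall : ∀ᶠ p in 𝓝[>] (0 : ℝ), p ∈ Set.Ioo (0 : ℝ) (1 / 2) :=
    Ioo_mem_nhdsGT (by norm_num)
  have hLq : Tendsto (fun p => 9 * (TwoStage.boxSide p : ℝ) ^ 2 * q p) (𝓝[>] 0) (𝓝 0) := by
    have h1 := hq0.const_mul 9
    rw [mul_zero] at h1
    refine squeeze_zero' ?_ ?_ h1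
    · filter_upwards [hq_pos] with p hp
      positivity
    · filter_upwards [hq_pos] with p hp
      have h0 : (0 : ℝ) ≤ TwoStage.boxSide p := Nat.cast_nonneg _
      rw [← mul_assoc]
      gcongr
      linarith
  have hε := (hLq.add hline).const_mul 14641
  rw [add_zero, mul_zero] at hε
  have hpow : Tendsto (fun p => (1 / 2 : ℝ) ^ TwoStage.boxSide p) (𝓝[>] 0) (𝓝 0) :=
    (tendsto_pow_atTop_nhds_zero_of_lt_one (by norm_num) (by norm_num)).comp hside
  have hF := (tendsto_const_nhds (x := (1 : ℝ))).sub ((hε.const_mul 3).add (hpow.const_mul 3))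
  simp only [mul_zero, add_zero, sub_zero] at hF
  have hF' := (ENNReal.continuous_ofReal.tendsto _).comp hF
  rw [ENNReal.ofReal_one] at hF'
  have hgood : ∀ᶠ p in 𝓝[>] (0 : ℝ), 0 < p ∧ p ≤ 1 / 2 ∧ 0 ≤ q p ∧ p + q p ≤ 1 ∧
      7 ≤ TwoStage.boxSide p ∧ (2 * (TwoStage.boxSide p : ℝ) + 1) ^ 2 * q p ≤ (1 / 2) ^ 128 := by
    filter_upwards [hsmall, hq_pos, hside.eventually_ge_atTop 7,
      hq0.eventually_le_const (show (0 : ℝ) < (1 / 2) ^ 128 by positivity)] with p hp hq hL h128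
    refine ⟨hp.1, hp.2.le, hq.le, ?_, hL, h128⟩
    have h1 : 1 * q p ≤ (2 * (TwoStage.boxSide p : ℝ) + 1) ^ 2 * q p := by
      gcongr
      have : (0 : ℝ) ≤ TwoStage.boxSide p := Nat.cast_nonneg _
      nlinarith
    have h2 : (1 / 2 : ℝ) ^ 128 ≤ (1 / 2) ^ 1 :=
      pow_le_pow_of_le_one (by norm_num) (by norm_num) (by norm_num)
    linarith [hp.2]
  refine tendsto_of_tendsto_of_tendsto_of_le_of_le' hF' tendsto_const_nhds ?_ ?_
  · filter_upwards [hgood, hε.eventually_le_const (show (0 : ℝ) < 1 / 6 by norm_num)]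
      with p ⟨hp, hp2, hq, hpq, hL, h128⟩ h6
    exact ENNReal.ofReal_le_of_le_toReal
      (TwoStage.prob_originLeavesZero_ge_of_scale v hp hp2 hq hpq hL (Nat.le_ceil _) h128 h6)
  · filter_upwards [hgood] with p ⟨hp, _, hq, hpq, _⟩
    have := TwoStage.isProbabilityMeasure_siteLaw hp.le hq hpq
    exact prob_le_one
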